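/- Let $n\ge 1$ be an integer and write $[m]=\{1,\dots,m\}$. Let $\mathcal T_n$ be the set of tableaux $T$ made of $n$ columns (numbered from left to right) and $2n$ rows (numbered from bottom to top), containing $2n$ dots, such that every row contains exactly one dot, every column contains exactly two dots, and if there is a dot in the box $(j,i)$ (column $j$, row $i$) then $j\le i$. A dot in the box $(j,i)$ is called free if $i\ge 2n+1-j$; let $\mathrm{fr}(T)$ be the number of free dots of $T$. Let $\mathrm{SP}_n$ be the set of surjective pistols, i.e. of surjective maps $f:[2n]\to\{2,4,\dots,2n\}$ such that $f(j)\ge j$ for all $j\in[2n]$. An integer $j\in[2n-2]$ is a doubled fixed point of $f$ if there is $j'<j$ with $f(j')=f(j)=j$; let $\mathrm{ndf}(f)$ be the number of elements of $\{2,4,\dots,2n\}$ that are not doubled fixed points of $f$ (thus $2n$ is always counted). Theorem. There exists a surjective map $\varphi:\mathcal T_n\to \mathrm{SP}_n$ such that, for all $f\in \mathrm{SP}_n$, $$\sum_{T\in\varphi^{-1}(f)}2^{\mathrm{fr}(T)}=2^{\mathrm{ndf}(f)}.$$ -/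

import Mathlib

/-- The segment `[m] = {1, 2, …, m}`. -/
abbrev Seg (m : ℕ) : Type := {k : ℕ // k ∈ Finset.Icc 1 m}

/-- The set `{2, 4, …, 2n}`. -/
abbrev Evens (n : ℕ) : Type := {k : ℕ // k ∈ (Finset.Icc 1 n).image (fun i => 2 * i)}

/-- The tableaux with `n` columns (numbered from left to right) and `2n` rows (numbered from bottom
to top): a tableau is identified with its set of dots, the pair `(j, i)` being the box in column `j`
and row `i`. Every row contains exactly one dot (so there are `2n` dots), every column contains
exactly two dots, and a dot in the box `(j, i)` forces `j ≤ i`. -/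
abbrev Tableau (n : ℕ) : Type :=
  {D : Finset (Seg n × Seg (2 * n)) //
    (∀ i : Seg (2 * n), (Finset.univ.filter (fun j : Seg n => (j, i) ∈ D)).card = 1) ∧
    (∀ j : Seg n, (Finset.univ.filter (fun i : Seg (2 * n) => (j, i) ∈ D)).card = 2) ∧
    (∀ (j : Seg n) (i : Seg (2 * n)), (j, i) ∈ D → (j : ℕ) ≤ (i : ℕ))}

/-- The number of free dots: those in a box `(j, i)` with `i ≥ 2n + 1 - j`. -/
def Tableau.fr {n : ℕ} (T : Tableau n) : ℕ :=
  (T.val.filter (fun d => 2 * n + 1 ≤ (d.2 : ℕ) + (d.1 : ℕ))).card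

/-- The surjective pistols: surjections `f : [2n] → {2, 4, …, 2n}` with `f j ≥ j` for all `j`. -/
abbrev SurjectivePistol (n : ℕ) : Type :=
  {f : Seg (2 * n) → Evens n //
    Function.Surjective f ∧ ∀ j : Seg (2 * n), (j : ℕ) ≤ (f j : ℕ)}

/-- The integer `m` is a doubled fixed point of `f`: `m ∈ [2n - 2]` and there is `j' < m` with
`f j' = f m = m`. -/
def SurjectivePistol.IsDoubledFixedPoint {n : ℕ} (f : SurjectivePistol n) (m : ℕ) : Prop :=
  m + 2 ≤ 2 * n ∧ ∃ j j' : Seg (2 * n), (j : ℕ) = m ∧ j' < j ∧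
    (f.val j' : ℕ) = m ∧ (f.val j : ℕ) = m

instance {n : ℕ} (f : SurjectivePistol n) (m : ℕ) : Decidable (f.IsDoubledFixedPoint m) := by
  unfold SurjectivePistol.IsDoubledFixedPoint
  infer_instance

/-- The number of elements of `{2, 4, …, 2n}` that are not doubled fixed points of `f`. -/
def SurjectivePistol.ndf {n : ℕ} (f : SurjectivePistol n) : ℕ :=
  (Finset.univ.filter (fun m : Evens n => ¬ f.IsDoubledFixedPoint (m : ℕ))).card

/-! ### Regrouping powers of two via polynomials. -/

section Refinement

open Polynomial

/-! The map is not built by hand: only the distributions of weights are compared. Put them in `ℕ[X]`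
as the sums of `X ^ fr T` and of `X ^ ndf f`. If the first arises from the second by repeatedly
trading `X ^ (i + 1)` for `2 * X ^ i`, the tableaux can be grouped into fibres with the required
sums (`Refines.exists_fibre_sum`). Surjectivity is then automatic, since an empty fibre has sum
zero.

Both polynomials obey a recursion in `k`. Column `k` of a tableau takes two of the remaining rows;
stage `k` of a pistol chooses `f (2k-1) = 2x` and `f (2k) = 2y`, remembering the set `A` of halved
values already taken. The dictionary pairs row `v < n` with row `2n - v`, and value `v` counts as
taken as soon as one row of its pair is used. Rows from `2n + 1 - k` on ("top" rows) are free in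
every column still to be filled. Row `n` is its own mirror image and matches value `n`, which
imposes no condition.

The live pairs split into `U`, `H`, `G`: two, one or no rows left. The comparison with pistols is
made after summing over the `2 ^ |H|` choices of surviving rows; this is the invariant `HalfBound`,
in which `A = H ∪ G` and the extra power of `X` accounts for the surplus top rows, which are bound
to be free. Removing a row corresponds to adding a value (`HalfBound.removeRow`). The induction step
`halfBound_tableauSum_succ` then asks whether pair `k` lies in `G`, `H` or `U`: row `k`, if left,
must go to column `k`, just as value `k` must be taken by stage `k`. For `U` the recursions match
term by term; for `G` and `H` one trade of `X * q` for `2 * q` is needed. -/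

/-- `Refines p q` says that the multiset of weights `2 ^ i` with multiplicities `p.coeff i` arises
from the one given by `q` by repeatedly splitting a weight into two equal halves. -/
def Refines (p q : ℕ[X]) : Prop := ∃ r : ℕ[X], p + X * r = q + 2 * r

namespace Refines

theorem refl (p : ℕ[X]) : Refines p p := ⟨0, by simp⟩

theorem of_eq {p q : ℕ[X]} (h : p = q) : Refines p q := h ▸ refl p

theorem trans {p q s : ℕ[X]} (h₁ : Refines p q) (h₂ : Refines q s) : Refines p s := by
  obtain ⟨r₁, e₁⟩ := h₁
  obtain ⟨r₂, e₂⟩ := h₂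
  refine ⟨r₁ + r₂, ?_⟩
  calc p + X * (r₁ + r₂) = (p + X * r₁) + X * r₂ := by ring
    _ = (q + X * r₂) + 2 * r₁ := by rw [e₁]; ring
    _ = s + 2 * (r₁ + r₂) := by rw [e₂]; ring

theorem add {p q p' q' : ℕ[X]} (h₁ : Refines p q) (h₂ : Refines p' q') :
    Refines (p + p') (q + q') := by
  obtain ⟨r₁, e₁⟩ := h₁
  obtain ⟨r₂, e₂⟩ := h₂
  refine ⟨r₁ + r₂, ?_⟩
  calc p + p' + X * (r₁ + r₂) = (p + X * r₁) + (p' + X * r₂) := by ring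
    _ = q + q' + 2 * (r₁ + r₂) := by rw [e₁, e₂]; ring

theorem mul_left (s : ℕ[X]) {p q : ℕ[X]} (h : Refines p q) : Refines (s * p) (s * q) := by
  obtain ⟨r, e⟩ := h
  refine ⟨s * r, ?_⟩
  calc s * p + X * (s * r) = s * (p + X * r) := by ring
    _ = s * q + 2 * (s * r) := by rw [e]; ring

theorem sum {ι : Type*} (s : Finset ι) {f g : ι → ℕ[X]} (h : ∀ i ∈ s, Refines (f i) (g i)) :
    Refines (∑ i ∈ s, f i) (∑ i ∈ s, g i) := by
  classical
  induction s using Finset.induction_on with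
  | empty => simpa using refl 0
  | insert i s hi ih =>
    rw [Finset.sum_insert hi, Finset.sum_insert hi]
    exact (h i (Finset.mem_insert_self i s)).add
      (ih fun j hj => h j (Finset.mem_insert_of_mem hj))

theorem two_mul_X_mul (p : ℕ[X]) : Refines (2 * p) (X * p) := ⟨p, by ring⟩

/-- Needed because rows are removed one at a time, which counts every column twice. The coefficients
of `X ^ (i + 1)` force each `r.coeff i` to be even, so the witness can be halved as well. -/
theorem of_two_mul {p q : ℕ[X]} (h : Refines (2 * p) (2 * q)) : Refines p q := by
  obtain ⟨r, e⟩ := h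
  have hr : ∀ i, 2 ∣ r.coeff i := by
    intro i
    have := congrArg (fun s => coeff s (i + 1)) e
    simp only [coeff_add, coeff_X_mul, coeff_ofNat_mul] at this
    omega
  have hC : (C 2 : ℕ[X]) ∣ r := (C_dvd_iff_dvd_coeff 2 r).2 hr
  obtain ⟨s, rfl⟩ := hC
  refine ⟨s, ?_⟩
  have h2 : (2 : ℕ[X]) ≠ 0 := two_ne_zero
  apply mul_left_cancel₀ h2
  have hC2 : (C 2 : ℕ[X]) = 2 := rfl
  rw [hC2] at e
  calc 2 * (p + X * s) = 2 * p + X * (2 * s) := by ring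
    _ = 2 * (q + 2 * s) := by rw [e]; ring

end Refines

theorem coeff_sum_X_pow {α : Type*} [Fintype α] (a : α → ℕ) (i : ℕ) :
    (∑ x, (X : ℕ[X]) ^ a x).coeff i = Fintype.card {x // a x = i} := by
  classical
  rw [finsetSum_coeff, Fintype.card_subtype, Finset.card_filter]
  refine Finset.sum_congr rfl fun x _ => ?_
  rw [coeff_X_pow]
  simp [eq_comm]

/-- Induction on the number `r.eval 1` of splittings. Splitting in the top degree `d` of `r` is
always possible: `r` has no coefficient at `d + 1`, so the identity there yields some `y₀` of weight
`2 ^ (d + 1)`. -/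
theorem exists_fibre_sum_of_add_eq (r : ℕ[X]) {α β : Type} [Fintype α] [Fintype β]
    [DecidableEq β] (a : α → ℕ) (b : β → ℕ)
    (h : ∑ x, (X : ℕ[X]) ^ a x + X * r = ∑ y, (X : ℕ[X]) ^ b y + 2 * r) :
    ∃ φ : α → β, ∀ y, ∑ x ∈ Finset.univ.filter (fun x => φ x = y), 2 ^ a x = 2 ^ b y := by
  classical
  induction hN : r.eval 1 generalizing r β with
  | zero =>
    have hr : r = 0 := by
      ext i
      have h0 : ∑ i ∈ Finset.range (r.natDegree + 1), r.coeff i = 0 := by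
        rw [← hN, eval_eq_sum_range]; simp
      rcases lt_or_ge r.natDegree i with hi | hi
      · simpa using coeff_eq_zero_of_natDegree_lt hi
      · simpa using (Finset.sum_eq_zero_iff.1 h0) i (Finset.mem_range.2 (by omega))
    subst hr
    simp only [mul_zero, add_zero] at h
    have hc : ∀ i, Fintype.card {x // a x = i} = Fintype.card {y // b y = i} := fun i => by
      rw [← coeff_sum_X_pow, ← coeff_sum_X_pow, h]
    let e : α ≃ β := Equiv.ofFiberEquiv (f := a) (g := b) fun i => Fintype.equivOfCardEq (hc i)
    have he : ∀ x, b (e x) = a x := fun x => Equiv.ofFiberEquiv_map _ x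
    refine ⟨e, fun y => ?_⟩
    have : Finset.univ.filter (fun x => e x = y) = {e.symm y} := by
      ext x; simp [Equiv.eq_symm_apply]
    rw [this, Finset.sum_singleton, ← he, e.apply_symm_apply]
  | succ N ih =>
    have hr0 : r ≠ 0 := by rintro rfl; simp at hN
    set d := r.natDegree with hd
    have hlead : r.coeff d ≠ 0 := leadingCoeff_ne_zero.2 hr0
    have hcoef := congrArg (fun s => coeff s (d + 1)) h
    have hhigh : r.coeff (d + 1) = 0 := coeff_eq_zero_of_natDegree_lt (by omega)
    simp only [coeff_add, coeff_X_mul, coeff_ofNat_mul, hhigh, mul_zero, add_zero] at hcoef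
    rw [coeff_sum_X_pow b] at hcoef
    have hpos : 0 < Fintype.card {y // b y = d + 1} := by omega
    obtain ⟨⟨y₀, hy₀⟩⟩ := Fintype.card_pos_iff.1 hpos
    obtain ⟨s, hs⟩ : ∃ s : ℕ[X], r = s + X ^ d := by
      refine ⟨r.erase d + C (r.coeff d - 1) * X ^ d, ?_⟩
      have h1 : (C (r.coeff d - 1) * X ^ d + X ^ d : ℕ[X]) = monomial d (r.coeff d) := by
        rw [← C_mul_X_pow_eq_monomial]
        have : r.coeff d = (r.coeff d - 1) + 1 := by omega
        conv_rhs => rw [this]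
        rw [C_add]; simp [add_mul]
      rw [add_assoc, h1, add_comm, monomial_add_erase]
    -- The two halves of `y₀` are `some y₀` and the new point `none`; they are glued back by `getD
    -- y₀`.
    let b' : Option β → ℕ := fun o => o.elim d fun y => if y = y₀ then d else b y
    have hsum : ∑ o, (X : ℕ[X]) ^ b' o + X ^ (d + 1) = ∑ y, X ^ b y + 2 * X ^ d := by
      rw [Fintype.sum_option, ← Finset.add_sum_erase _ _ (Finset.mem_univ y₀),
        ← Finset.add_sum_erase _ (fun y => (X : ℕ[X]) ^ b y) (Finset.mem_univ y₀)]
      have : ∑ y ∈ Finset.univ.erase y₀, (X : ℕ[X]) ^ b' (some y) =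
          ∑ y ∈ Finset.univ.erase y₀, X ^ b y := by
        refine Finset.sum_congr rfl fun y hy => ?_
        simp [b', Finset.ne_of_mem_erase hy]
      rw [this, hy₀]
      simp only [b', Option.elim_none, Option.elim_some, if_true]
      ring
    have hs' : ∑ x, (X : ℕ[X]) ^ a x + X * s = ∑ o, X ^ b' o + 2 * s := by
      rw [hs] at h
      suffices hc : ∑ x, (X : ℕ[X]) ^ a x + X * s + X ^ (d + 1) =
          ∑ o, X ^ b' o + 2 * s + X ^ (d + 1) by
        ext i
        simpa using congrArg (fun q => coeff q i) hc
      calc _ = ∑ x, (X : ℕ[X]) ^ a x + X * (s + X ^ d) := by ring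
        _ = (∑ y, X ^ b y + 2 * X ^ d) + 2 * s := by rw [h]; ring
        _ = _ := by rw [← hsum]; ring
    obtain ⟨ψ, hψ⟩ := ih s b' hs' (by
      have : eval 1 r = eval 1 s + 1 := by rw [hs]; simp
      omega)
    refine ⟨fun x => (ψ x).getD y₀, fun y => ?_⟩
    by_cases hy : y = y₀
    · subst hy
      have : Finset.univ.filter (fun x => (ψ x).getD y = y) =
          Finset.univ.filter (fun x => ψ x = none) ∪
            Finset.univ.filter (fun x => ψ x = some y) := by
        ext x
        cases hx : ψ x <;> simp [hx]
      rw [this, Finset.sum_union, hψ, hψ, hy₀]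
      · simp [b', pow_succ]; ring
      · rw [Finset.disjoint_filter]
        intro x _ h1 h2
        rw [h1] at h2
        cases h2
    · have : Finset.univ.filter (fun x => (ψ x).getD y₀ = y) =
          Finset.univ.filter (fun x => ψ x = some y) := by
        ext x
        cases hx : ψ x <;> simp [hx, Ne.symm hy]
      rw [this, hψ]
      simp [b', hy]

/-- If the weights `2 ^ a x` refine the weights `2 ^ b y`, then they can be grouped accordingly. -/
theorem Refines.exists_fibre_sum {α β : Type} [Fintype α] [Fintype β] [DecidableEq β]
    {a : α → ℕ} {b : β → ℕ} (h : Refines (∑ x, X ^ a x) (∑ y, X ^ b y)) :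
    ∃ φ : α → β, Function.Surjective φ ∧
      ∀ y, ∑ x ∈ Finset.univ.filter (fun x => φ x = y), 2 ^ a x = 2 ^ b y := by
  obtain ⟨r, hr⟩ := h
  obtain ⟨φ, hφ⟩ := exists_fibre_sum_of_add_eq r a b hr
  refine ⟨φ, fun y => ?_, hφ⟩
  by_contra hy
  have h0 : Finset.univ.filter (fun x => φ x = y) = ∅ :=
    Finset.filter_eq_empty_iff.2 fun x _ hx => hy ⟨x, hx⟩
  have := hφ y
  rw [h0, Finset.sum_empty] at this
  exact (pow_ne_zero _ two_ne_zero) this.symm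

end Refinement

/-! ### Recursions by column and by stage. -/

section Recursion

open Polynomial

/-- The weight of a dot in row `i` of column `k`. -/
noncomputable def rowWeight (n k i : ℕ) : ℕ[X] := if 2 * n + 1 ≤ i + k then X else 1

/-- Generating polynomial of the fillings of the `m` columns `k, k + 1, …` by the rows in `R`. -/
noncomputable def tableauSum (n : ℕ) : ℕ → ℕ → Finset ℕ → ℕ[X]
  | 0, _, R => if R = ∅ then 1 else 0
  | m + 1, k, R => ∑ S ∈ R.powersetCard 2,
      (if ∀ i ∈ S, k ≤ i then ∏ i ∈ S, rowWeight n k i else 0) *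
        tableauSum n m (k + 1) (R \ S)

/-- The weight of the choice `f (2 * k - 1) = 2 * x`, `f (2 * k) = 2 * y` when the values already
taken are those in `A`. -/
noncomputable def valueWeight (n k : ℕ) (A : Finset ℕ) (x y : ℕ) : ℕ[X] :=
  if k ∈ insert x (insert y A) then (if y = k ∧ (x = k ∨ k ∈ A) ∧ k < n then 1 else X) else 0

/-- Generating polynomial of the pistols on the last `2 * m` positions `2 * k - 1, 2 * k, …`, when
the values already taken are those in `A`. -/
noncomputable def pistolSum (n : ℕ) : ℕ → ℕ → Finset ℕ → ℕ[X]
  | 0, _, _ => 1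
  | m + 1, k, A => ∑ x ∈ Finset.Icc k n, ∑ y ∈ Finset.Icc k n,
      valueWeight n k A x y * pistolSum n m (k + 1) (insert x (insert y A))

theorem two_mul_sum_powersetCard_two {M : Type*} [Semiring M] (R : Finset ℕ)
    (φ : Finset ℕ → M) :
    2 * ∑ S ∈ R.powersetCard 2, φ S = ∑ i ∈ R, ∑ j ∈ R.erase i, φ {i, j} := by
  induction R using Finset.induction_on with
  | empty => rw [Finset.powersetCard_eq_empty.2 (by simp)]; simp
  | insert a R ha ih =>
    have h1 : ∑ S ∈ (insert a R).powersetCard 2, φ S =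
        ∑ S ∈ R.powersetCard 2, φ S + ∑ j ∈ R, φ {a, j} := by
      rw [Finset.powersetCard_succ_insert ha, Finset.sum_union, Finset.sum_image,
        Finset.powersetCard_one, Finset.sum_map]
      · rfl
      · intro S hS T hT h
        have hS' : a ∉ S := fun h => ha ((Finset.mem_powersetCard.1 hS).1 h)
        have hT' : a ∉ T := fun h => ha ((Finset.mem_powersetCard.1 hT).1 h)
        rw [← Finset.erase_insert hS', ← Finset.erase_insert hT', h]
      · rw [Finset.disjoint_left]
        intro S hS hS'
        obtain ⟨T, _, rfl⟩ := Finset.mem_image.1 hS'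
        exact ha ((Finset.mem_powersetCard.1 hS).1 (Finset.mem_insert_self a T))
    rw [h1, mul_add, ih, Finset.sum_insert ha, Finset.erase_insert ha, two_mul]
    have h2 : ∀ i ∈ R, ∑ j ∈ (insert a R).erase i, φ {i, j} =
        φ {a, i} + ∑ j ∈ R.erase i, φ {i, j} := by
      intro i hi
      have hia : a ≠ i := fun h => ha (h ▸ hi)
      rw [Finset.erase_insert_of_ne hia, Finset.sum_insert (by simp [ha]), Finset.pair_comm]
    rw [Finset.sum_congr rfl h2, Finset.sum_add_distrib]
    abel

/-- Remove one row, in all possible ways, with the weights of column `k`. -/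
noncomputable def removeRow (n k : ℕ) (F : Finset ℕ → ℕ[X]) (R : Finset ℕ) : ℕ[X] :=
  ∑ i ∈ R, rowWeight n k i * F (R.erase i)

theorem tableauSum_eq_zero {n m k j : ℕ} {R : Finset ℕ} (hj : j ∈ R) (hjk : j < k) :
    tableauSum n m k R = 0 := by
  induction m generalizing k R with
  | zero => simp [tableauSum, Finset.ne_empty_of_mem hj]
  | succ m ih =>
    rw [tableauSum]
    refine Finset.sum_eq_zero fun S _ => ?_
    by_cases hS : ∀ i ∈ S, k ≤ i
    · have : j ∈ R \ S := Finset.mem_sdiff.2 ⟨hj, fun h => by have := hS j h; omega⟩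
      rw [ih this (by omega), mul_zero]
    · rw [if_neg hS, zero_mul]

/-- A column takes an unordered pair of rows; removing them one after the other sees each pair in
both orders. -/
theorem two_mul_tableauSum_succ {n m k : ℕ} {R : Finset ℕ} (hR : ∀ i ∈ R, k ≤ i) :
    2 * tableauSum n (m + 1) k R =
      removeRow n k (removeRow n k (tableauSum n m (k + 1))) R := by
  rw [tableauSum, two_mul_sum_powersetCard_two, removeRow]
  refine Finset.sum_congr rfl fun i hi => ?_
  rw [removeRow, Finset.mul_sum]
  refine Finset.sum_congr rfl fun j hj => ?_
  have hij : i ≠ j := (Finset.ne_of_mem_erase hj).symm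
  have hj' := Finset.mem_of_mem_erase hj
  rw [if_pos, Finset.prod_pair hij, mul_assoc]
  · congr 3
    ext x
    simp only [Finset.mem_sdiff, Finset.mem_insert, Finset.mem_singleton, Finset.mem_erase]
    tauto
  · intro x hx
    rcases Finset.mem_insert.1 hx with rfl | hx
    · exact hR _ hi
    · rw [Finset.mem_singleton.1 hx]; exact hR _ hj'

/-- Row `k` is too low for later columns, so column `k` must take it, with a non-free dot as `2k ≤
2n`. Only its partner remains to be chosen. -/
theorem tableauSum_succ_insert {n m k : ℕ} {R : Finset ℕ} (hR : ∀ i ∈ R, k < i) (hk : k ≤ n) :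
    tableauSum n (m + 1) k (insert k R) = removeRow n k (tableauSum n m (k + 1)) R := by
  have hkR : k ∉ R := fun h => lt_irrefl k (hR k h)
  have hw : rowWeight n k k = 1 := if_neg (by omega)
  apply mul_left_cancel₀ (two_ne_zero (α := ℕ[X]))
  rw [two_mul_tableauSum_succ]
  · rw [removeRow, Finset.sum_insert hkR, Finset.erase_insert hkR, hw, one_mul, two_mul]
    congr 1
    rw [removeRow]
    refine Finset.sum_congr rfl fun i hi => ?_
    have hki : k ≠ i := (hR i hi).ne
    rw [Finset.erase_insert_of_ne hki, removeRow,
      Finset.sum_eq_single_of_mem k (Finset.mem_insert_self _ _), hw, one_mul,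
      Finset.erase_insert (by simp [hkR])]
    -- If neither removed row is `k`, row `k` is stranded.
    intro j _ hj
    rw [tableauSum_eq_zero (j := k), mul_zero]
    · simp [hj.symm]
    · omega
  · intro i hi
    rcases Finset.mem_insert.1 hi with rfl | hi
    · exact le_rfl
    · exact (hR i hi).le

theorem removeRow_insert {n k t : ℕ} (F : Finset ℕ → ℕ[X]) {R : Finset ℕ} (ht : t ∉ R)
    (hw : rowWeight n k t = 1) :
    removeRow n k F (insert t R) = F R + removeRow n k (fun R => F (insert t R)) R := by
  rw [removeRow, Finset.sum_insert ht, Finset.erase_insert ht, hw, one_mul]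
  congr 1
  refine Finset.sum_congr rfl fun i hi => ?_
  rw [Finset.erase_insert_of_ne (by rintro rfl; exact ht hi)]

theorem removeRow_removeRow_insert {n k t : ℕ} (F : Finset ℕ → ℕ[X]) {R : Finset ℕ}
    (ht : t ∉ R) (hw : rowWeight n k t = 1) :
    removeRow n k (removeRow n k F) (insert t R) =
      2 * removeRow n k F R +
        removeRow n k (removeRow n k fun R => F (insert t R)) R := by
  rw [removeRow_insert _ ht hw, two_mul, add_assoc]
  congr 1
  rw [removeRow, removeRow, removeRow, ← Finset.sum_add_distrib]
  refine Finset.sum_congr rfl fun i hi => ?_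
  rw [removeRow_insert _ (fun h => ht (Finset.mem_of_mem_erase h)) hw, mul_add]

/-- The sum of `p (insert y A)` over the values `y > k`. -/
noncomputable def insertSum (n k : ℕ) (p : Finset ℕ → ℕ[X]) (A : Finset ℕ) : ℕ[X] :=
  ∑ y ∈ Finset.Icc (k + 1) n, p (insert y A)

theorem pistolSum_insert_of_lt {n m k j : ℕ} (A : Finset ℕ) (hj : j < k) :
    pistolSum n m k (insert j A) = pistolSum n m k A := by
  induction m generalizing k A with
  | zero => rfl
  | succ m ih =>
    rw [pistolSum, pistolSum]
    refine Finset.sum_congr rfl fun x _ => Finset.sum_congr rfl fun y _ => ?_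
    have h1 : valueWeight n k (insert j A) x y = valueWeight n k A x y := by
      have : k ≠ j := hj.ne'
      simp [valueWeight, this]
    rw [h1, Finset.insert_comm y j, Finset.insert_comm x j, ih _ (by omega)]

/-- Membership of `n` could matter only at stage `n`, where `y = n` is forced and the weight is `X`
in any case. -/
theorem pistolSum_insert_self {n m k : ℕ} (A : Finset ℕ) (hk : k + m = n + 1) :
    pistolSum n m k (insert n A) = pistolSum n m k A := by
  induction m generalizing k A with
  | zero => rfl
  | succ m ih =>
    rw [pistolSum, pistolSum]
    refine Finset.sum_congr rfl fun x hx => Finset.sum_congr rfl fun y hy => ?_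
    rw [Finset.mem_Icc] at hx hy
    have h1 : valueWeight n k (insert n A) x y = valueWeight n k A x y := by
      rcases (show k ≤ n by omega).lt_or_eq with h | h
      · have : k ≠ n := h.ne
        simp [valueWeight, this]
      · have : y = n := by omega
        simp [valueWeight, h, this]
    rw [h1, Finset.insert_comm y n, Finset.insert_comm x n, ih _ (by omega)]

theorem Icc_eq_insert {k n : ℕ} (h : k ≤ n) :
    Finset.Icc k n = insert k (Finset.Icc (k + 1) n) := by
  ext x; simp only [Finset.mem_Icc, Finset.mem_insert]; omega

/-- Value `k` is out of reach after stage `k`, so `x` or `y` equals `k`. The choice `(k, k)` is a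
doubled fixed point of weight `1`; `(k, y)` and `(y, k)` each weigh `X`. -/
theorem pistolSum_succ_of_notMem {n m k : ℕ} {A : Finset ℕ} (hk : k < n) (hA : k ∉ A) :
    pistolSum n (m + 1) k A = pistolSum n m (k + 1) A +
      2 * X * insertSum n k (pistolSum n m (k + 1)) A := by
  have hk' : ∀ y ∈ Finset.Icc (k + 1) n, k ≠ y := fun y hy => by
    rw [Finset.mem_Icc] at hy; omega
  have hp : ∀ B, pistolSum n m (k + 1) (insert k B) = pistolSum n m (k + 1) B :=
    fun B => pistolSum_insert_of_lt B (by omega)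
  have h1 : ∑ y ∈ Finset.Icc k n, valueWeight n k A k y *
      pistolSum n m (k + 1) (insert k (insert y A)) = pistolSum n m (k + 1) A +
        X * insertSum n k (pistolSum n m (k + 1)) A := by
    rw [Icc_eq_insert hk.le, Finset.sum_insert (by simp), insertSum, Finset.mul_sum]
    congr 1
    · simp [valueWeight, hk, hp]
    · refine Finset.sum_congr rfl fun y hy => ?_
      simp [valueWeight, hp, (hk' y hy).symm]
  have h2 : ∀ x ∈ Finset.Icc (k + 1) n, ∑ y ∈ Finset.Icc k n, valueWeight n k A x y *
      pistolSum n m (k + 1) (insert x (insert y A)) =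
        X * pistolSum n m (k + 1) (insert x A) := by
    intro x hx
    rw [Finset.sum_eq_single_of_mem k (by simp [hk.le])]
    · rw [Finset.insert_comm, hp]
      simp [valueWeight, hA, (hk' x hx).symm]
    · intro y _ hy
      simp [valueWeight, hA, hk' x hx, hy.symm]
  rw [pistolSum, Icc_eq_insert hk.le, Finset.sum_insert (by simp), ← Icc_eq_insert hk.le, h1,
    Finset.sum_congr rfl h2, ← Finset.mul_sum, insertSum]
  ring

/-- Here `k` is a doubled fixed point exactly when `y = k`, whatever `x` is. -/
theorem pistolSum_succ_of_mem {n m k : ℕ} {A : Finset ℕ} (hk : k < n) (hA : k ∈ A) :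
    pistolSum n (m + 1) k A = pistolSum n m (k + 1) A +
      insertSum n k (pistolSum n m (k + 1)) A +
      X * (insertSum n k (pistolSum n m (k + 1)) A +
        insertSum n k (insertSum n k (pistolSum n m (k + 1))) A) := by
  have hk' : ∀ y ∈ Finset.Icc (k + 1) n, y ≠ k := fun y hy => by
    rw [Finset.mem_Icc] at hy; omega
  have hp : ∀ B, pistolSum n m (k + 1) (insert k B) = pistolSum n m (k + 1) B :=
    fun B => pistolSum_insert_of_lt B (by omega)
  have h1 : ∀ B, ∑ x ∈ Finset.Icc k n, pistolSum n m (k + 1) (insert x B) =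
      pistolSum n m (k + 1) B + insertSum n k (pistolSum n m (k + 1)) B := by
    intro B
    rw [Icc_eq_insert hk.le, Finset.sum_insert (by simp), hp, insertSum]
  rw [pistolSum, Finset.sum_comm, Icc_eq_insert hk.le, Finset.sum_insert (by simp),
    ← Icc_eq_insert hk.le]
  congr 1
  · rw [← h1]
    refine Finset.sum_congr rfl fun x _ => ?_
    simp [valueWeight, hA, hk]
  · have : ∀ y ∈ Finset.Icc (k + 1) n, ∑ x ∈ Finset.Icc k n, valueWeight n k A x y *
        pistolSum n m (k + 1) (insert x (insert y A)) =
          X * (pistolSum n m (k + 1) (insert y A) +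
            insertSum n k (pistolSum n m (k + 1)) (insert y A)) := by
      intro y hy
      rw [← h1, Finset.mul_sum]
      refine Finset.sum_congr rfl fun x _ => ?_
      simp [valueWeight, hA, hk' y hy]
    rw [Finset.sum_congr rfl this, ← Finset.mul_sum, Finset.sum_add_distrib]
    rfl

end Recursion

/-! ### Row sets as mirrored pairs, and half-sums. -/

section Domination

open Polynomial

/-- The rows `i` and `2 * n - j` for `i ∈ a` and `j ∈ b`, together with the rows in `m` and `t`. -/
def rowSet (n : ℕ) (a b m t : Finset ℕ) : Finset ℕ :=
  a ∪ b.image (fun j => 2 * n - j) ∪ m ∪ t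

theorem mem_rowSet {n i : ℕ} {a b m t : Finset ℕ} :
    i ∈ rowSet n a b m t ↔ i ∈ a ∨ (∃ j ∈ b, 2 * n - j = i) ∨ i ∈ m ∨ i ∈ t := by
  simp only [rowSet, Finset.mem_union, Finset.mem_image, or_assoc]

theorem rowSet_insert_right (n i : ℕ) (a b m t : Finset ℕ) :
    rowSet n a b m (insert i t) = insert i (rowSet n a b m t) := by
  simp [rowSet]

theorem rowSet_insert_low (n i : ℕ) (a b m t : Finset ℕ) :
    rowSet n (insert i a) b m t = insert i (rowSet n a b m t) := by
  simp [rowSet]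

theorem rowSet_insert_up (n i : ℕ) (a b m t : Finset ℕ) :
    rowSet n a (insert i b) m t = insert (2 * n - i) (rowSet n a b m t) := by
  simp [rowSet]

/-- The standing assumptions on the components of a row set at stage `k`. -/
structure RowSetBounds (n k : ℕ) (a b m t : Finset ℕ) : Prop where
  low : a ⊆ Finset.Ico (k + 1) n
  up : b ⊆ Finset.Ico (k + 1) n
  mid : m ⊆ {n}
  top : t ⊆ Finset.Icc (2 * n + 1 - k) (2 * n)

theorem RowSetBounds.mem_bounds {n k i : ℕ} {a b m t : Finset ℕ}
    (h : RowSetBounds n k a b m t) (hk : k < n) (hi : i ∈ rowSet n a b m t) :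
    k < i ∧ i ≠ 2 * n - k := by
  rcases mem_rowSet.1 hi with hi | ⟨j, hj, rfl⟩ | hi | hi
  · have := Finset.mem_Ico.1 (h.low hi); omega
  · have := Finset.mem_Ico.1 (h.up hj); omega
  · have := Finset.mem_singleton.1 (h.mid hi); omega
  · have := Finset.mem_Icc.1 (h.top hi); omega

/-- Only top rows are free in column `k`: a mirrored row `2n - j` has `j > k`, hence `2n - j + k <
2n`. -/
theorem removeRow_rowSet {n k : ℕ} {a b m t : Finset ℕ} (hk : k < n)
    (h : RowSetBounds n k a b m t) (F : Finset ℕ → ℕ[X]) :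
    removeRow n k F (rowSet n a b m t) =
      ∑ i ∈ a, F (rowSet n (a.erase i) b m t) + ∑ i ∈ b, F (rowSet n a (b.erase i) m t) +
      ∑ i ∈ m, F (rowSet n a b (m.erase i) t) + X * ∑ i ∈ t, F (rowSet n a b m (t.erase i)) := by
  have ha : ∀ i ∈ a, k < i ∧ i < n := fun i hi => by
    have := Finset.mem_Ico.1 (h.low hi); omega
  have hb : ∀ i ∈ b, k < i ∧ i < n := fun i hi => by
    have := Finset.mem_Ico.1 (h.up hi); omega
  have hm : ∀ i ∈ m, i = n := fun i hi => Finset.mem_singleton.1 (h.mid hi)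
  have ht : ∀ i ∈ t, 2 * n + 1 - k ≤ i ∧ i ≤ 2 * n := fun i hi => Finset.mem_Icc.1 (h.top hi)
  rw [removeRow, rowSet, Finset.sum_union, Finset.sum_union, Finset.sum_union, Finset.sum_image,
    Finset.mul_sum]
  · congr 1
    · congr 1
      · congr 1
        · refine Finset.sum_congr rfl fun i hi => ?_
          have := ha i hi
          rw [rowWeight, if_neg (by omega), one_mul]
          congr 1
          ext x
          simp only [Finset.mem_erase, Finset.mem_union, Finset.mem_image, mem_rowSet]
          have h1 : ∀ j ∈ b, 2 * n - j ≠ i := fun j hj => by have := hb j hj; omega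
          have h2 : i ∉ m := fun hi' => by have := hm i hi'; omega
          have h3 : i ∉ t := fun hi' => by have := ht i hi'; omega
          by_cases hx : x = i
          · subst hx; simp_all
          · simp [hx, or_assoc]
        · refine Finset.sum_congr rfl fun i hi => ?_
          have := hb i hi
          rw [rowWeight, if_neg (by omega), one_mul]
          congr 1
          ext x
          simp only [Finset.mem_erase, Finset.mem_union, Finset.mem_image, mem_rowSet]
          have h1 : 2 * n - i ∉ a := fun hi' => by have := ha _ hi'; omega
          have h2 : 2 * n - i ∉ m := fun hi' => by have := hm _ hi'; omega
          have h3 : 2 * n - i ∉ t := fun hi' => by have := ht _ hi'; omega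
          by_cases hx : x = 2 * n - i
          · subst hx
            simp only [ne_eq, not_true_eq_false, false_and, h1, h2, h3, false_or, or_false,
              false_iff, not_exists, not_and]
            intro j hj
            have := hb j hj.2
            omega
          · have : ∀ j ∈ b, (2 * n - j = x ↔ j ≠ i ∧ 2 * n - j = x) := by
              intro j _
              constructor
              · intro h; exact ⟨fun hji => hx (by rw [← h, hji]), h⟩
              · exact fun h => h.2
            have h4 : (∃ j ∈ b, 2 * n - j = x) ↔ ∃ j, (j ≠ i ∧ j ∈ b) ∧ 2 * n - j = x := by
              constructor
              · rintro ⟨j, hj, e⟩; exact ⟨j, ⟨((this j hj).1 e).1, hj⟩, e⟩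
              · rintro ⟨j, ⟨_, hj⟩, e⟩; exact ⟨j, hj, e⟩
            rw [h4]
            simp [hx, or_assoc]
      · refine Finset.sum_congr rfl fun i hi => ?_
        have := hm i hi
        rw [rowWeight, if_neg (by omega), one_mul]
        congr 1
        ext x
        simp only [Finset.mem_erase, Finset.mem_union, Finset.mem_image, mem_rowSet]
        have h0 : i ∉ a := fun hi' => by have := ha _ hi'; omega
        have h1 : ∀ j ∈ b, 2 * n - j ≠ i := fun j hj => by have := hb j hj; omega
        have h3 : i ∉ t := fun hi' => by have := ht i hi'; omega
        by_cases hx : x = i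
        · subst hx; simp_all
        · simp [hx, or_assoc]
    · refine Finset.sum_congr rfl fun i hi => ?_
      have := ht i hi
      rw [rowWeight, if_pos (by omega)]
      congr 2
      ext x
      simp only [Finset.mem_erase, Finset.mem_union, Finset.mem_image, mem_rowSet]
      have h0 : i ∉ a := fun hi' => by have := ha _ hi'; omega
      have h1 : ∀ j ∈ b, 2 * n - j ≠ i := fun j hj => by have := hb j hj; omega
      have h3 : i ∉ m := fun hi' => by have := hm i hi'; omega
      by_cases hx : x = i
      · subst hx; simp_all
      · simp [hx, or_assoc]
  · intro x hx y hy hxy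
    have := hb x hx
    have := hb y hy
    simp only at hxy
    omega
  · rw [Finset.disjoint_left]
    intro x hx hx'
    obtain ⟨j, hj, rfl⟩ := Finset.mem_image.1 hx'
    have := hb j hj
    have := ha _ hx
    omega
  · rw [Finset.disjoint_left]
    intro x hx hx'
    have := hm x hx'
    rcases Finset.mem_union.1 hx with hx | hx
    · have := ha _ hx; omega
    · obtain ⟨j, hj, rfl⟩ := Finset.mem_image.1 hx
      have := hb j hj
      omega
  · rw [Finset.disjoint_left]
    intro x hx hx'
    have := ht x hx'
    rcases Finset.mem_union.1 hx with hx | hx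
    · rcases Finset.mem_union.1 hx with hx | hx
      · have := ha _ hx; omega
      · obtain ⟨j, hj, rfl⟩ := Finset.mem_image.1 hx
        have := hb j hj
        omega
    · have := hm x hx; omega

/-- The sum of `F` over the row sets that contain both rows of each pair in `U` and exactly one
row of each pair in `H`. -/
noncomputable def halfSum (n : ℕ) (F : Finset ℕ → ℕ[X]) (H U m t : Finset ℕ) : ℕ[X] :=
  ∑ L ∈ H.powerset, F (rowSet n (U ∪ L) (U ∪ (H \ L)) m t)

theorem halfSum_insert {n v : ℕ} (F : Finset ℕ → ℕ[X]) {H U m t : Finset ℕ} (hv : v ∉ H) :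
    halfSum n F (insert v H) U m t =
      ∑ L ∈ H.powerset, (F (rowSet n (U ∪ L) (insert v (U ∪ (H \ L))) m t) +
        F (rowSet n (insert v (U ∪ L)) (U ∪ (H \ L)) m t)) := by
  rw [halfSum, Finset.sum_powerset_insert hv, ← Finset.sum_add_distrib]
  refine Finset.sum_congr rfl fun L hL => ?_
  have hvL : v ∉ L := fun h => hv (Finset.mem_powerset.1 hL h)
  congr 3
  · rw [Finset.insert_sdiff_of_notMem _ hvL, Finset.union_insert]
  · rw [Finset.union_insert]
  · rw [Finset.insert_sdiff_insert, Finset.sdiff_insert_of_notMem hv]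

/-- Removing the surviving row of a pair `v ∈ H` gives the same set whichever row survived, hence
the factor 2. Removing either row of a pair `u ∈ U` gives precisely the two choices summed over once
`u` joins `H`, hence no factor. -/
theorem halfSum_removeRow {n k : ℕ} {H U m t : Finset ℕ} (hk : k < n)
    (hH : H ⊆ Finset.Ico (k + 1) n) (hU : U ⊆ Finset.Ico (k + 1) n) (hHU : Disjoint H U)
    (hm : m ⊆ {n}) (ht : t ⊆ Finset.Icc (2 * n + 1 - k) (2 * n)) (F : Finset ℕ → ℕ[X]) :
    halfSum n (removeRow n k F) H U m t =
      2 * ∑ v ∈ H, halfSum n F (H.erase v) U m t +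
      ∑ u ∈ U, halfSum n F (insert u H) (U.erase u) m t +
      ∑ i ∈ m, halfSum n F H U (m.erase i) t +
      X * ∑ i ∈ t, halfSum n F H U m (t.erase i) := by
  have hb : ∀ L ∈ H.powerset, RowSetBounds n k (U ∪ L) (U ∪ (H \ L)) m t := fun L hL =>
    ⟨Finset.union_subset hU ((Finset.mem_powerset.1 hL).trans hH),
      Finset.union_subset hU (Finset.sdiff_subset.trans hH), hm, ht⟩
  rw [halfSum, Finset.sum_congr rfl fun L hL => removeRow_rowSet hk (hb L hL) F]
  simp only [Finset.sum_add_distrib]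
  rw [← Finset.mul_sum, Finset.sum_comm (s := H.powerset) (t := m),
    Finset.sum_comm (s := H.powerset) (t := t)]
  simp only [halfSum]
  congr 2
  have h1 : ∀ L ∈ H.powerset,
      ∑ i ∈ U ∪ L, F (rowSet n ((U ∪ L).erase i) (U ∪ (H \ L)) m t) +
        ∑ i ∈ U ∪ (H \ L), F (rowSet n (U ∪ L) ((U ∪ (H \ L)).erase i) m t) =
      ∑ v ∈ H, F (rowSet n (U ∪ L.erase v) (U ∪ ((H.erase v) \ (L.erase v))) m t) +
      ∑ u ∈ U, (F (rowSet n (U.erase u ∪ L) (insert u (U.erase u ∪ (H \ L))) m t) +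
        F (rowSet n (insert u (U.erase u ∪ L)) (U.erase u ∪ (H \ L)) m t)) := by
    intro L hL
    have hL := Finset.mem_powerset.1 hL
    have hUL : Disjoint U L := (hHU.mono_left hL).symm
    have hUHL : Disjoint U (H \ L) := (hHU.mono_left Finset.sdiff_subset).symm
    rw [Finset.sum_union hUL, Finset.sum_union hUHL, ← Finset.sum_sdiff hL,
      Finset.sum_add_distrib]
    have e1 : ∑ i ∈ L, F (rowSet n ((U ∪ L).erase i) (U ∪ (H \ L)) m t) =
        ∑ v ∈ L, F (rowSet n (U ∪ L.erase v) (U ∪ ((H.erase v) \ (L.erase v))) m t) := by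
      refine Finset.sum_congr rfl fun i hi => ?_
      have hiU : i ∉ U := fun h => Finset.disjoint_left.1 hUL h hi
      congr 2
      · rw [Finset.erase_union_distrib, Finset.erase_eq_of_notMem hiU]
      · congr 1
        ext x; simp only [Finset.mem_sdiff, Finset.mem_erase]
        by_cases hx : x = i
        · subst hx; simp [hi]
        · simp [hx]
    have e2 : ∑ i ∈ H \ L, F (rowSet n (U ∪ L) ((U ∪ (H \ L)).erase i) m t) =
        ∑ v ∈ H \ L, F (rowSet n (U ∪ L.erase v) (U ∪ ((H.erase v) \ (L.erase v))) m t) := by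
      refine Finset.sum_congr rfl fun i hi => ?_
      have hiU : i ∉ U := fun h => Finset.disjoint_left.1 hUHL h hi
      have hiL : i ∉ L := (Finset.mem_sdiff.1 hi).2
      rw [Finset.erase_union_distrib, Finset.erase_eq_of_notMem hiU,
        Finset.erase_eq_of_notMem hiL, Finset.erase_sdiff_comm]
    have e3 : ∑ i ∈ U, F (rowSet n ((U ∪ L).erase i) (U ∪ (H \ L)) m t) =
        ∑ u ∈ U, F (rowSet n (U.erase u ∪ L) (insert u (U.erase u ∪ (H \ L))) m t) := by
      refine Finset.sum_congr rfl fun i hi => ?_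
      have hiL : i ∉ L := fun h => Finset.disjoint_left.1 hUL hi h
      rw [Finset.erase_union_distrib, Finset.erase_eq_of_notMem hiL, ← Finset.insert_union,
        Finset.insert_erase hi]
    have e4 : ∑ i ∈ U, F (rowSet n (U ∪ L) ((U ∪ (H \ L)).erase i) m t) =
        ∑ u ∈ U, F (rowSet n (insert u (U.erase u ∪ L)) (U.erase u ∪ (H \ L)) m t) := by
      refine Finset.sum_congr rfl fun i hi => ?_
      have hiL : i ∉ H \ L := fun h => Finset.disjoint_left.1 hUHL hi h
      rw [Finset.erase_union_distrib, Finset.erase_eq_of_notMem hiL, ← Finset.insert_union,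
        Finset.insert_erase hi]
    rw [e1, e2, e3, e4]
    abel
  rw [← Finset.sum_add_distrib, Finset.sum_congr rfl h1, Finset.sum_add_distrib,
    Finset.sum_comm (s := H.powerset) (t := H), Finset.sum_comm (s := H.powerset) (t := U)]
  congr 1
  · rw [Finset.mul_sum]
    refine Finset.sum_congr rfl fun v hv => ?_
    conv_lhs => rw [← Finset.insert_erase hv]
    rw [Finset.sum_powerset_insert (Finset.notMem_erase v H), two_mul]
    rw [Finset.insert_erase hv]
    congr 1
    · refine Finset.sum_congr rfl fun L hL => ?_
      rw [Finset.erase_eq_of_notMem fun h =>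
        Finset.notMem_erase v H (Finset.mem_powerset.1 hL h)]
    · refine Finset.sum_congr rfl fun L hL => ?_
      rw [Finset.erase_insert fun h =>
        Finset.notMem_erase v H (Finset.mem_powerset.1 hL h)]
  · refine Finset.sum_congr rfl fun u hu => ?_
    rw [← halfSum_insert F (fun h => Finset.disjoint_left.1 hHU h hu), halfSum]

end Domination

/-! ### The invariant and its behaviour under row removal. -/

section Domination

open Polynomial

/-- The sums `halfSum n F H U m t` are bounded by `p (H ∪ G)`, up to the factor that accounts for
the rows already used; `G` is the set of pairs of which both rows are used, the rows in `t` are at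
least `T`, and `t` has `c` more rows than the other rows already used. -/
def HalfBound (n k T c : ℕ) (F p : Finset ℕ → ℕ[X]) : Prop :=
  ∀ (H G m t : Finset ℕ) (e : ℕ), H ⊆ Finset.Ico k n → G ⊆ Finset.Ico k n →
    Disjoint H G → m ⊆ {n} → t ⊆ Finset.Icc T (2 * n) → m.card + e = 1 →
    t.card = H.card + 2 * G.card + e + c →
    Refines (halfSum n F H (Finset.Ico k n \ (H ∪ G)) m t)
      (2 ^ H.card * X ^ (H.card + 2 * G.card + e) * p (H ∪ G))

/-- The values in `A` and the value `n` leave `p A` unchanged, whence the coefficient `A.card + 1`.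
-/
theorem insertSum_eq {n k : ℕ} {A : Finset ℕ} {p : Finset ℕ → ℕ[X]} (hk : k < n)
    (hA : A ⊆ Finset.Ico (k + 1) n) (hp : p (insert n A) = p A) :
    insertSum n k p A = ((A.card + 1 : ℕ) : ℕ[X]) * p A +
      ∑ u ∈ Finset.Ico (k + 1) n \ A, p (insert u A) := by
  have h1 : Finset.Icc (k + 1) n = insert n (Finset.Ico (k + 1) n) := by
    ext x; simp only [Finset.mem_Icc, Finset.mem_insert, Finset.mem_Ico]; omega
  rw [insertSum, h1, Finset.sum_insert (by simp), hp, ← Finset.sum_sdiff hA]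
  have h2 : ∑ y ∈ A, p (insert y A) = (A.card : ℕ[X]) * p A := by
    rw [Finset.sum_congr rfl fun y hy => by rw [Finset.insert_eq_of_mem hy], Finset.sum_const,
      nsmul_eq_mul]
  rw [h2]
  push_cast
  ring

/-- Each removal lowers the surplus of top rows by one: a top row leaves `t`, or one more other row
is used. The coefficient of `p A` counts the rows whose removal does not enlarge `A`. -/
theorem HalfBound.removeRow {n k c : ℕ} {F p : Finset ℕ → ℕ[X]} (hk : k < n)
    (hp : ∀ A, p (insert n A) = p A) (h : HalfBound n (k + 1) (2 * n + 1 - k) c F p) :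
    HalfBound n (k + 1) (2 * n + 1 - k) (c + 1) (removeRow n k F)
      (fun A => X * ((c : ℕ[X]) * p A + 2 * insertSum n k p A)) := by
  intro H G m t e hH hG hHG hm ht hme htc
  set U := Finset.Ico (k + 1) n \ (H ∪ G) with hU
  set E := H.card + 2 * G.card + e with hE
  have hHU : Disjoint H U := by
    rw [Finset.disjoint_left]
    intro x hx hx'
    exact (Finset.mem_sdiff.1 hx').2 (Finset.mem_union_left _ hx)
  rw [halfSum_removeRow hk hH Finset.sdiff_subset hHU hm ht]
  -- Pair `v` passes from `H` to `G`; the factor 2 restores the power lost with `H.erase v`.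
  have b1 : ∀ v ∈ H, Refines (2 * halfSum n F (H.erase v) U m t)
      (2 ^ H.card * X ^ (E + 1) * p (H ∪ G)) := by
    intro v hv
    have hvG : v ∉ G := Finset.disjoint_left.1 hHG hv
    have hun : H.erase v ∪ insert v G = H ∪ G := by
      ext x; simp only [Finset.mem_union, Finset.mem_erase, Finset.mem_insert]
      by_cases hx : x = v
      · subst hx; simp [hv]
      · simp [hx]
    have hc := Finset.card_erase_add_one hv
    have hcG := Finset.card_insert_of_notMem hvG
    have := h (H.erase v) (insert v G) m t e ((Finset.erase_subset _ _).trans hH)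
      (Finset.insert_subset (hH hv) hG)
      (by
        rw [Finset.disjoint_left]
        intro x hx hx'
        rcases Finset.mem_insert.1 hx' with rfl | hx'
        · exact Finset.notMem_erase _ _ hx
        · exact Finset.disjoint_left.1 hHG (Finset.mem_of_mem_erase hx) hx')
      hm ht hme (by omega)
    rw [hun] at this
    have h2 := this.mul_left 2
    have hexp : (H.erase v).card + 2 * (insert v G).card + e = E + 1 := by omega
    rw [hexp] at h2
    rw [← hc, pow_succ]
    convert h2 using 1
    ring
  -- Pair `u` enters `H`, so `A` gains `u` and the power of 2 goes up by one.
  have b2 : ∀ u ∈ U, Refines (halfSum n F (insert u H) (U.erase u) m t)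
      (2 ^ H.card * X ^ (E + 1) * (2 * p (insert u (H ∪ G)))) := by
    intro u hu
    obtain ⟨hu1, hu2⟩ := Finset.mem_sdiff.1 hu
    have huH : u ∉ H := fun h => hu2 (Finset.mem_union_left _ h)
    have huG : u ∉ G := fun h => hu2 (Finset.mem_union_right _ h)
    have hc := Finset.card_insert_of_notMem huH
    have := h (insert u H) G m t e (Finset.insert_subset hu1 hH) hG
      (Finset.disjoint_insert_left.2 ⟨huG, hHG⟩) hm ht hme (by omega)
    rw [Finset.insert_union, Finset.sdiff_insert, hc,
      show H.card + 1 + 2 * G.card + e = E + 1 by omega] at this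
    convert this using 1
    ring
  have b3 : ∀ i ∈ m, Refines (halfSum n F H U (m.erase i) t)
      (2 ^ H.card * X ^ (E + 1) * p (H ∪ G)) := by
    intro i hi
    have hc := Finset.card_erase_add_one hi
    have := h H G (m.erase i) t (e + 1) hH hG hHG ((Finset.erase_subset _ _).trans hm) ht
      (by omega) (by omega)
    exact this
  have b4 : ∀ i ∈ t, Refines (X * halfSum n F H U m (t.erase i))
      (2 ^ H.card * X ^ (E + 1) * p (H ∪ G)) := by
    intro i hi
    have hc := Finset.card_erase_add_one hi
    have := (h H G m (t.erase i) e hH hG hHG hm ((Finset.erase_subset _ _).trans ht)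
      hme (by omega)).mul_left X
    convert this using 1
    ring
  rw [Finset.mul_sum, Finset.mul_sum]
  refine ((((Refines.sum H b1).add (Refines.sum U b2)).add (Refines.sum m b3)).add
    (Refines.sum t b4)).trans (Refines.of_eq ?_)
  beta_reduce
  rw [insertSum_eq hk (Finset.union_subset hH hG) (hp _), ← hU]
  simp only [Finset.sum_const, nsmul_eq_mul, ← Finset.mul_sum]
  rw [Finset.card_union_of_disjoint hHG, htc]
  have hm' : (m.card : ℕ[X]) + e = 1 := by exact_mod_cast hme
  have hE' : (E : ℕ[X]) = H.card + 2 * G.card + e := by rw [hE]; push_cast; ring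
  push_cast
  rw [hE']
  -- With `A = H ∪ G`, the coefficient `|H| + |m| + |t|` equals `2|A| + c + 2`, since `|m| + e = 1`.
  calc _ = 2 ^ H.card * X ^ (E + 1) * (((2 * H.card + 2 * G.card + c + 1 : ℕ[X]) +
        ((m.card : ℕ[X]) + (e : ℕ[X]))) * p (H ∪ G) + 2 * ∑ u ∈ U, p (insert u (H ∪ G))) := by ring
    _ = _ := by rw [hm']; ring

theorem HalfBound.mono {n k T T' c : ℕ} {F p : Finset ℕ → ℕ[X]} (hT : T ≤ T')
    (h : HalfBound n (k + 1) T c F p) : HalfBound n (k + 1) T' c F p :=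
  fun H G m t e hH hG hHG hm ht => h H G m t e hH hG hHG hm
    (ht.trans (Finset.Icc_subset_Icc_left hT))

/-- Row `2n - k`, not free in column `k`, is a top row from stage `k + 1` on. Kept through column
`k`, it accounts for one unit of the surplus. -/
theorem HalfBound.insert_top {n k c : ℕ} {F p : Finset ℕ → ℕ[X]} (hk : k < n)
    (h : HalfBound n (k + 1) (2 * n - k) (c + 1) F p) :
    HalfBound n (k + 1) (2 * n + 1 - k) c (fun R => F (insert (2 * n - k) R)) p := by
  intro H G m t e hH hG hHG hm ht hme htc
  have hnt : 2 * n - k ∉ t := fun h => by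
    have := Finset.mem_Icc.1 (ht h); omega
  have := h H G m (insert (2 * n - k) t) e hH hG hHG hm
    (Finset.insert_subset (Finset.mem_Icc.2 ⟨le_rfl, by omega⟩)
      (ht.trans (Finset.Icc_subset_Icc_left (by omega)))) hme
    (by rw [Finset.card_insert_of_notMem hnt]; omega)
  simpa only [halfSum, rowSet_insert_right] using this

theorem insertSum_insert {n k j : ℕ} {p : Finset ℕ → ℕ[X]} (hp : ∀ A, p (insert j A) = p A)
    (A : Finset ℕ) : insertSum n k p (insert j A) = insertSum n k p A :=
  Finset.sum_congr rfl fun y _ => by rw [Finset.insert_comm, hp]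

end Domination

/-! ### Induction from the last column down to the first. -/

section Domination

open Polynomial

theorem insertSum_scaled (n k : ℕ) (p : Finset ℕ → ℕ[X]) (c : ℕ) (A : Finset ℕ) :
    insertSum n k (fun B => X * ((c : ℕ[X]) * p B + 2 * insertSum n k p B)) A =
      X * ((c : ℕ[X]) * insertSum n k p A + 2 * insertSum n k (insertSum n k p) A) := by
  simp only [insertSum, Finset.sum_add_distrib, Finset.mul_sum, mul_add]

/-- No pairs are left. The last column takes the `e + 1` top rows, all free, and row `n` if unused,
which is not free as `n + n < 2n + 1`. -/
theorem halfBound_tableauSum_last (n : ℕ) :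
    HalfBound n n (2 * n + 1 - n) 1 (tableauSum n 1 n) (pistolSum n 1 n) := by
  intro H G m t e hH hG _ hm ht hme htc
  rw [Finset.Ico_self, Finset.subset_empty] at hH hG
  subst hH hG
  have hdis : Disjoint m t := by
    rw [Finset.disjoint_left]
    intro x hx hx'
    have h1 := Finset.mem_singleton.1 (hm hx)
    have h2 := Finset.mem_Icc.1 (ht hx')
    omega
  simp only [Finset.card_empty] at htc
  have hcard : (m ∪ t).card = 2 := by rw [Finset.card_union_of_disjoint hdis]; omega
  have hrow : rowSet n ∅ ∅ m t = m ∪ t := by simp [rowSet]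
  have hge : ∀ i ∈ m ∪ t, n ≤ i := by
    intro i hi
    rcases Finset.mem_union.1 hi with hi | hi
    · exact (Finset.mem_singleton.1 (hm hi)).ge
    · have := Finset.mem_Icc.1 (ht hi); omega
  have hprod : ∏ i ∈ m ∪ t, rowWeight n n i = X ^ t.card := by
    rw [Finset.prod_union hdis, Finset.prod_eq_one, one_mul, Finset.prod_eq_pow_card]
    · intro i hi
      have := Finset.mem_Icc.1 (ht hi)
      exact if_pos (by omega)
    · intro i hi
      have := Finset.mem_singleton.1 (hm hi)
      exact if_neg (by omega)
  have hV : tableauSum n 1 n (m ∪ t) = X ^ t.card := by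
    rw [tableauSum]
    conv_lhs => rw [← hcard, Finset.powersetCard_self]
    rw [Finset.sum_singleton, if_pos hge, hprod, Finset.sdiff_self]
    simp [tableauSum]
  have hP : pistolSum n 1 n ∅ = X := by
    simp [pistolSum, valueWeight]
  refine Refines.of_eq ?_
  simp only [halfSum, Finset.powerset_empty, Finset.sum_singleton, Finset.Ico_self,
    Finset.empty_sdiff, Finset.union_empty, hrow, hV, hP, htc, Finset.card_empty]
  ring

theorem halfBound_tableauSum_succ {n m k : ℕ} (hkm : k + (m + 1) = n)
    (ih : HalfBound n (k + 1) (2 * n + 1 - (k + 1)) 1 (tableauSum n (m + 1) (k + 1))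
      (pistolSum n (m + 1) (k + 1))) :
    HalfBound n k (2 * n + 1 - k) 1 (tableauSum n (m + 2) k) (pistolSum n (m + 2) k) := by
  have hk : k < n := by omega
  have hT : 2 * n + 1 - (k + 1) = 2 * n - k := by omega
  rw [hT] at ih
  set F := tableauSum n (m + 1) (k + 1) with hF
  set p := pistolSum n (m + 1) (k + 1) with hpdef
  have hpn : ∀ A, p (insert n A) = p A := fun A => pistolSum_insert_self A (by omega)
  have hpk : ∀ A, p (insert k A) = p A := fun A => pistolSum_insert_of_lt A (by omega)
  have hNn : ∀ c : ℕ, ∀ A, (fun B => X * ((c : ℕ[X]) * p B + 2 * insertSum n k p B)) (insert n A) =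
      (fun B => X * ((c : ℕ[X]) * p B + 2 * insertSum n k p B)) A := fun c A => by
    simp only [hpn, insertSum_insert hpn]
  have hNk := insertSum_insert (n := n) (k := k) hpk
  have hNNk := insertSum_insert (n := n) (k := k) hNk
  -- In the `B` bounds row `2n - k` is gone, with zero, one, two rows removed; in the `C` bounds it
  -- survives column `k`, again with zero, one, two removals.
  have B1 : HalfBound n (k + 1) (2 * n + 1 - k) 1 F p := ih.mono (by omega)
  have B2 := B1.removeRow hk hpn
  have B3 := B2.removeRow hk (hNn 1)
  have C0 := HalfBound.insert_top hk ih
  have C1 := C0.removeRow hk hpn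
  have C2 := C1.removeRow hk (hNn 0)
  intro H G mm t e hH hG hHG hm ht hme htc
  have hw : rowWeight n k (2 * n - k) = 1 := if_neg (by omega)
  have hsub : ∀ S : Finset ℕ, S ⊆ Finset.Ico k n → k ∉ S → S ⊆ Finset.Ico (k + 1) n := by
    intro S hS hkS x hx
    have h1 := Finset.mem_Ico.1 (hS hx)
    have h2 : x ≠ k := fun h => hkS (h ▸ hx)
    rw [Finset.mem_Ico]
    omega
  by_cases hkG : k ∈ G
  · have hkH : k ∉ H := fun h => Finset.disjoint_left.1 hHG h hkG
    have hH' := hsub H hH hkH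
    have hG' := hsub (G.erase k) ((Finset.erase_subset _ _).trans hG) (Finset.notMem_erase _ _)
    have hHG' : Disjoint H (G.erase k) := hHG.mono_right (Finset.erase_subset _ _)
    have hA : H ∪ G = insert k (H ∪ G.erase k) := by
      rw [← Finset.union_insert, Finset.insert_erase hkG]
    have hU : Finset.Ico k n \ (H ∪ G) = Finset.Ico (k + 1) n \ (H ∪ G.erase k) := by
      ext x
      rw [hA]
      simp only [Finset.mem_sdiff, Finset.mem_Ico, Finset.mem_insert]
      constructor
      · rintro ⟨h1, h2⟩
        have := not_or.1 h2
        exact ⟨by omega, this.2⟩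
      · rintro ⟨h1, h2⟩
        exact ⟨by omega, not_or.2 ⟨by omega, h2⟩⟩
    have hc := Finset.card_erase_add_one hkG
    have key := B3 H (G.erase k) mm t e hH' hG' hHG' hm ht hme (by omega)
    rw [hU, hA, pistolSum_succ_of_mem hk (Finset.mem_insert_self _ _), ← hpdef, hpk, hNk, hNNk]
    apply Refines.of_two_mul
    have h2 : 2 * halfSum n (tableauSum n (m + 2) k) H
        (Finset.Ico (k + 1) n \ (H ∪ G.erase k)) mm t =
        halfSum n (removeRow n k (removeRow n k F)) H
          (Finset.Ico (k + 1) n \ (H ∪ G.erase k)) mm t := by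
      rw [halfSum, halfSum, Finset.mul_sum]
      refine Finset.sum_congr rfl fun L hL => ?_
      have hb : RowSetBounds n k (Finset.Ico (k + 1) n \ (H ∪ G.erase k) ∪ L)
          (Finset.Ico (k + 1) n \ (H ∪ G.erase k) ∪ (H \ L)) mm t :=
        ⟨Finset.union_subset Finset.sdiff_subset ((Finset.mem_powerset.1 hL).trans hH'),
          Finset.union_subset Finset.sdiff_subset (Finset.sdiff_subset.trans hH'), hm, ht⟩
      exact two_mul_tableauSum_succ fun i hi => (hb.mem_bounds hk hi).1.le
    rw [h2]
    refine key.trans ?_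
    beta_reduce
    rw [insertSum_scaled, show H.card + 2 * G.card + e = H.card + 2 * (G.erase k).card + e + 2 by
      omega]
    set E := H.card + 2 * (G.erase k).card + e
    set A := H ∪ G.erase k
    set N := insertSum n k p A
    set NN := insertSum n k (insertSum n k p) A
    -- Up to the common factor, `B3` gives `2p + 6N + 4NN = 2(p + N) + 4(N + NN)`, and `4(N + NN)`
    -- is traded for `2X(N + NN)`.
    refine Refines.trans (Refines.of_eq ?_) (((Refines.refl
      (2 * (2 ^ H.card * X ^ (E + 2)) * (p A + N))).add (Refines.two_mul_X_mul
      (2 * (2 ^ H.card * X ^ (E + 2)) * (N + NN)))).trans (Refines.of_eq ?_))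
    · push_cast; ring
    · ring
  have hG' := hsub G hG hkG
  by_cases hkH : k ∈ H
  · have hH' := hsub (H.erase k) ((Finset.erase_subset _ _).trans hH) (Finset.notMem_erase _ _)
    have hHG' : Disjoint (H.erase k) G := hHG.mono_left (Finset.erase_subset _ _)
    have hA : H ∪ G = insert k (H.erase k ∪ G) := by
      rw [← Finset.insert_union, Finset.insert_erase hkH]
    have hU : Finset.Ico k n \ (H ∪ G) = Finset.Ico (k + 1) n \ (H.erase k ∪ G) := by
      ext x
      rw [hA]
      simp only [Finset.mem_sdiff, Finset.mem_Ico, Finset.mem_insert]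
      constructor
      · rintro ⟨h1, h2⟩
        have := not_or.1 h2
        exact ⟨by omega, this.2⟩
      · rintro ⟨h1, h2⟩
        exact ⟨by omega, not_or.2 ⟨by omega, h2⟩⟩
    have hc := Finset.card_erase_add_one hkH
    have key2 := C2 (H.erase k) G mm t e hH' hG' hHG' hm ht hme (by omega)
    have key1 := B2 (H.erase k) G mm t e hH' hG' hHG' hm ht hme (by omega)
    rw [hU, hA, pistolSum_succ_of_mem hk (Finset.mem_insert_self _ _), ← hpdef, hpk, hNk, hNNk]
    apply Refines.of_two_mul
    -- The 4 is 2 + 2: row `k` survives and is forced, or row `2n - k` survives and is chosen, each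
    -- counted in two orders.
    have h2 : 2 * halfSum n (tableauSum n (m + 2) k) H
        (Finset.Ico (k + 1) n \ (H.erase k ∪ G)) mm t =
        halfSum n (removeRow n k (removeRow n k fun R => F (insert (2 * n - k) R))) (H.erase k)
          (Finset.Ico (k + 1) n \ (H.erase k ∪ G)) mm t +
        4 * halfSum n (removeRow n k F) (H.erase k)
          (Finset.Ico (k + 1) n \ (H.erase k ∪ G)) mm t := by
      conv_lhs => rw [← Finset.insert_erase hkH]
      rw [halfSum_insert _ (Finset.notMem_erase k H), halfSum, halfSum, Finset.mul_sum,
        Finset.mul_sum, ← Finset.sum_add_distrib, Finset.erase_insert (Finset.notMem_erase k H)]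
      refine Finset.sum_congr rfl fun L hL => ?_
      have hb : RowSetBounds n k (Finset.Ico (k + 1) n \ (H.erase k ∪ G) ∪ L)
          (Finset.Ico (k + 1) n \ (H.erase k ∪ G) ∪ (H.erase k \ L)) mm t :=
        ⟨Finset.union_subset Finset.sdiff_subset ((Finset.mem_powerset.1 hL).trans hH'),
          Finset.union_subset Finset.sdiff_subset (Finset.sdiff_subset.trans hH'), hm, ht⟩
      have hR := fun i hi => hb.mem_bounds (i := i) hk hi
      rw [rowSet_insert_up, rowSet_insert_low, mul_add, two_mul_tableauSum_succ,
        tableauSum_succ_insert (fun i hi => (hR i hi).1) hk.le,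
        removeRow_removeRow_insert _ (fun h => (hR _ h).2 rfl) hw]
      · ring
      · intro i hi
        rcases Finset.mem_insert.1 hi with rfl | hi
        · omega
        · exact (hR i hi).1.le
    rw [h2]
    refine (key2.add (key1.mul_left 4)).trans ?_
    beta_reduce
    rw [insertSum_scaled, show H.card + 2 * G.card + e = (H.erase k).card + 2 * G.card + e + 1 by
      omega, ← hc]
    set E := (H.erase k).card + 2 * G.card + e
    set A := H.erase k ∪ G
    set N := insertSum n k p A
    set NN := insertSum n k (insertSum n k p) A
    set K : ℕ[X] := 2 ^ (H.erase k).card * X ^ E with hK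
    -- The single trade here is `4XN` for `2X²N`.
    refine Refines.trans (Refines.of_eq ?_) (((Refines.refl
      (K * (2 * X ^ 2 * N + 4 * X ^ 2 * NN + 4 * X * p A + 4 * X * N))).add (Refines.two_mul_X_mul
      (K * (2 * X * N)))).trans (Refines.of_eq ?_))
    · push_cast; ring
    · rw [hK]; ring
  · have hH' := hsub H hH hkH
    have hkA : k ∉ H ∪ G := fun h => (Finset.mem_union.1 h).elim hkH hkG
    have hU : Finset.Ico k n \ (H ∪ G) = insert k (Finset.Ico (k + 1) n \ (H ∪ G)) := by
      ext x
      simp only [Finset.mem_sdiff, Finset.mem_Ico, Finset.mem_insert]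
      by_cases hx : x = k
      · subst hx
        simp [hkA, hk]
      · have : k ≤ x ↔ k + 1 ≤ x := by omega
        simp [hx, this]
    have key1 := B1 H G mm t e hH' hG' hHG hm ht hme htc
    have key2 := C1 H G mm t e hH' hG' hHG hm ht hme (by omega)
    rw [hU, pistolSum_succ_of_notMem hk hkA, ← hpdef]
    -- Row `k` is forced; its partner is row `2n - k`, matching `x = y = k`, or another row, while
    -- `2n - k` becomes a top row.
    have h2 : halfSum n (tableauSum n (m + 2) k) H
        (insert k (Finset.Ico (k + 1) n \ (H ∪ G))) mm t =
        halfSum n F H (Finset.Ico (k + 1) n \ (H ∪ G)) mm t +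
        halfSum n (removeRow n k fun R => F (insert (2 * n - k) R)) H
          (Finset.Ico (k + 1) n \ (H ∪ G)) mm t := by
      rw [halfSum, halfSum, halfSum, ← Finset.sum_add_distrib]
      refine Finset.sum_congr rfl fun L hL => ?_
      have hb : RowSetBounds n k (Finset.Ico (k + 1) n \ (H ∪ G) ∪ L)
          (Finset.Ico (k + 1) n \ (H ∪ G) ∪ (H \ L)) mm t :=
        ⟨Finset.union_subset Finset.sdiff_subset ((Finset.mem_powerset.1 hL).trans hH'),
          Finset.union_subset Finset.sdiff_subset (Finset.sdiff_subset.trans hH'), hm, ht⟩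
      have hR := fun i hi => hb.mem_bounds (i := i) hk hi
      rw [Finset.insert_union, Finset.insert_union, rowSet_insert_low, rowSet_insert_up,
        tableauSum_succ_insert _ hk.le, removeRow_insert _ (fun h => (hR _ h).2 rfl) hw]
      intro i hi
      rcases Finset.mem_insert.1 hi with rfl | hi
      · omega
      · exact (hR i hi).1
    rw [h2]
    refine (key1.add key2).trans (Refines.of_eq ?_)
    push_cast
    ring

theorem halfBound_tableauSum {n m k : ℕ} (hkm : k + m = n) :
    HalfBound n k (2 * n + 1 - k) 1 (tableauSum n (m + 1) k) (pistolSum n (m + 1) k) := by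
  induction m generalizing k with
  | zero =>
    obtain rfl : k = n := by omega
    exact halfBound_tableauSum_last k
  | succ m ih => exact halfBound_tableauSum_succ hkm (ih (by omega))

/-- The tableaux on all rows refine the pistols on all positions. -/
theorem tableauSum_refines_pistolSum {n : ℕ} (hn : 1 ≤ n) :
    Refines (tableauSum n n 1 (Finset.Icc 1 (2 * n))) (pistolSum n n 1 ∅) := by
  obtain ⟨m, rfl⟩ : ∃ m, n = m + 1 := ⟨n - 1, by omega⟩
  -- Initially all pairs and row `n` are unused, and the only top row is `2n`: the surplus is 1.
  have := halfBound_tableauSum (n := m + 1) (m := m) (k := 1) (by omega) ∅ ∅ {m + 1}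
    {2 * (m + 1)} 0 (Finset.empty_subset _) (Finset.empty_subset _) (Finset.disjoint_empty_left _)
    subset_rfl (by simp) (by simp) (by simp)
  have hrow : rowSet (m + 1) (Finset.Ico 1 (m + 1)) (Finset.Ico 1 (m + 1)) {m + 1}
      {2 * (m + 1)} = Finset.Icc 1 (2 * (m + 1)) := by
    ext i
    simp only [mem_rowSet, Finset.mem_Ico, Finset.mem_singleton, Finset.mem_Icc]
    constructor
    · rintro (h | ⟨j, hj, rfl⟩ | h | h) <;> omega
    · intro h
      by_cases h1 : i < m + 1
      · exact Or.inl (by omega)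
      by_cases h2 : i = m + 1
      · exact Or.inr (Or.inr (Or.inl h2))
      by_cases h3 : i = 2 * (m + 1)
      · exact Or.inr (Or.inr (Or.inr h3))
      · exact Or.inr (Or.inl ⟨2 * (m + 1) - i, by omega, by omega⟩)
  simpa [halfSum, hrow] using this

end Domination

/-! ### Identifying `tableauSum` with the sum over tableaux. -/

section TableauEnumeration

open Polynomial

/-- The sets `g 0, g 1, …` are the rows of the dots in the columns `k, k + 1, …` of a filling of
the rows in `R`. -/
def IsFilling {N : ℕ} (m k : ℕ) (R : Finset (Seg N)) (g : Fin m → Finset (Seg N)) : Prop :=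
  (∀ i, (g i).card = 2 ∧ ∀ r ∈ g i, k + (i : ℕ) ≤ (r : ℕ)) ∧ (∀ r, r ∈ R ↔ ∃ i, r ∈ g i) ∧
    ∀ r i j, r ∈ g i → r ∈ g j → i = j

theorem isFilling_cons {N m k : ℕ} {R S : Finset (Seg N)} {g : Fin m → Finset (Seg N)} :
    IsFilling (m + 1) k R (Fin.cons S g : Fin (m + 1) → Finset (Seg N)) ↔
      (S ⊆ R ∧ S.card = 2 ∧ ∀ r ∈ S, k ≤ (r : ℕ)) ∧ IsFilling m (k + 1) (R \ S) g := by
  simp only [IsFilling, Fin.forall_fin_succ, Fin.exists_fin_succ, Fin.cons_zero, Fin.cons_succ,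
    Fin.val_zero, Fin.val_succ, add_zero, Finset.mem_sdiff]
  have e : ∀ i : Fin m, k + ((i : ℕ) + 1) = k + 1 + i := fun i => by ring
  simp only [e]
  constructor
  · rintro ⟨⟨⟨h1, h2⟩, h3⟩, h4, h5⟩
    refine ⟨⟨fun r hr => (h4 r).2 (Or.inl hr), h1, h2⟩, h3, fun r => ⟨?_, ?_⟩, ?_⟩
    · rintro ⟨hr, hrS⟩
      exact ((h4 r).1 hr).resolve_left hrS
    · rintro ⟨i, hi⟩
      exact ⟨(h4 r).2 (Or.inr ⟨i, hi⟩), fun hS => (Fin.succ_ne_zero i) ((h5 r).2 i |>.1 hi hS)⟩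
    · intro r i j hi hj
      exact Fin.succ_injective _ (((h5 r).2 i).2 j hi hj)
  · rintro ⟨⟨h1, h2, h3⟩, h4, h5, h6⟩
    have hd : ∀ r (i : Fin m), r ∈ S → r ∉ g i := fun r i hS hi => ((h5 r).2 ⟨i, hi⟩).2 hS
    refine ⟨⟨⟨h2, h3⟩, h4⟩, fun r => ⟨fun hr => ?_, ?_⟩, fun r => ⟨⟨?_, ?_⟩, fun i => ⟨?_, ?_⟩⟩⟩
    · by_cases hS : r ∈ S
      · exact Or.inl hS
      · exact Or.inr ((h5 r).1 ⟨hr, hS⟩)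
    · rintro (hr | hr)
      · exact h1 hr
      · exact ((h5 r).2 hr).1
    · intro _ _; trivial
    · intro i hS hi; exact absurd hi (hd r i hS)
    · intro hi hS; exact absurd hi (hd r i hS)
    · intro j hi hj; rw [h6 r i j hi hj]

/-- The rows in `R`, as natural numbers. -/
abbrev rowVals {N : ℕ} (R : Finset (Seg N)) : Finset ℕ := R.map (Function.Embedding.subtype _)

open Classical in
theorem tableauSum_eq_sum_fillings {n m k N : ℕ} (R : Finset (Seg N)) :
    tableauSum n m k (rowVals R) = ∑ g : Fin m → Finset (Seg N),
      if IsFilling m k R g then ∏ i, ∏ r ∈ g i, rowWeight n (k + (i : ℕ)) r else 0 := by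
  induction m generalizing k R with
  | zero =>
    have h : ∀ g : Fin 0 → Finset (Seg N), IsFilling 0 k R g ↔ R = ∅ := fun g => by
      simp [IsFilling, Finset.eq_empty_iff_forall_notMem]
    simp [tableauSum, h]
  | succ m ih =>
    rw [← (Fin.consEquiv fun _ : Fin (m + 1) => Finset (Seg N)).sum_comp, Fintype.sum_prod_type,
      tableauSum, Finset.powersetCard_map, Finset.sum_map]
    have h1 : Finset.powersetCard 2 R =
        Finset.univ.filter fun S : Finset (Seg N) => S ⊆ R ∧ S.card = 2 := by
      ext S; simp [Finset.mem_powersetCard]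
    rw [h1, Finset.sum_filter]
    refine Finset.sum_congr rfl fun (S : Finset (Seg N)) _ => ?_
    have h2 : (rowVals R) \ (rowVals S) = rowVals (R \ S) := (Finset.map_sdiff _ _).symm
    simp only [Finset.mapEmbedding_apply, RelEmbedding.coe_toEmbedding]
    rw [h2, ih]
    simp only [Fin.consEquiv, Equiv.coe_fn_mk, isFilling_cons, Fin.prod_univ_succ, Fin.cons_zero,
      Fin.cons_succ, Finset.forall_mem_map, Finset.prod_map, Function.Embedding.subtype_apply]
    by_cases hS : S ⊆ R ∧ S.card = 2
    · rw [if_pos hS]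
      by_cases hS' : ∀ r ∈ S, k ≤ (r : ℕ)
      · rw [if_pos (fun r hr => hS' r hr), Finset.mul_sum]
        refine Finset.sum_congr rfl fun g _ => ?_
        have e : ∀ i : Fin m, k + 1 + (i : ℕ) = k + ((i.succ : Fin (m + 1)) : ℕ) := fun i => by
          rw [Fin.val_succ]; ring
        by_cases hF : IsFilling m (k + 1) (R \ S) g
        · rw [if_pos hF, if_pos ⟨⟨hS.1, hS.2, hS'⟩, hF⟩]
          simp only [e, Fin.val_zero, add_zero]
        · rw [if_neg hF, if_neg fun h => hF h.2, mul_zero]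
      · rw [if_neg (fun h => hS' fun r hr => h r hr), zero_mul]
        symm
        refine Finset.sum_eq_zero fun g _ => if_neg fun h => hS' h.1.2.2
    · rw [if_neg hS]
      symm
      refine Finset.sum_eq_zero fun g _ => if_neg fun h => hS ⟨h.1.1, h.1.2.1⟩

/-- The numbering of `[n]` starting from zero. -/
def segEquiv (n : ℕ) : Fin n ≃ Seg n where
  toFun i := ⟨1 + i, Finset.mem_Icc.2 ⟨by omega, by omega⟩⟩
  invFun j := ⟨j - 1, by have := Finset.mem_Icc.1 j.2; omega⟩
  left_inv i := by ext; simp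
  right_inv j := by
    have := Finset.mem_Icc.1 j.2
    ext
    simp only
    omega

/-- The rows of the dots in the columns of a set of dots. -/
def columnRows {n N : ℕ} (D : Finset (Seg n × Seg N)) (i : Fin n) : Finset (Seg N) :=
  Finset.univ.filter fun r => (segEquiv n i, r) ∈ D

theorem columnRows_bijective (n N : ℕ) :
    Function.Bijective (columnRows : Finset (Seg n × Seg N) → Fin n → Finset (Seg N)) := by
  constructor
  · intro D D' h
    ext ⟨j, r⟩
    have := congrArg (fun s => r ∈ s) (congrFun h ((segEquiv n).symm j))
    simpa [columnRows] using this
  · intro g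
    refine ⟨Finset.univ.filter fun d => d.2 ∈ g ((segEquiv n).symm d.1), ?_⟩
    funext i
    ext r
    simp [columnRows]

theorem isFilling_columnRows {n : ℕ} (D : Finset (Seg n × Seg (2 * n))) :
    IsFilling n 1 Finset.univ (columnRows D) ↔
      ((∀ i : Seg (2 * n), (Finset.univ.filter (fun j : Seg n => (j, i) ∈ D)).card = 1) ∧
      (∀ j : Seg n, (Finset.univ.filter (fun i : Seg (2 * n) => (j, i) ∈ D)).card = 2) ∧
      (∀ (j : Seg n) (i : Seg (2 * n)), (j, i) ∈ D → (j : ℕ) ≤ (i : ℕ))) := by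
  have hmem : ∀ i r, r ∈ columnRows D i ↔ (segEquiv n i, r) ∈ D := fun i r => by
    simp [columnRows]
  simp only [IsFilling, hmem, Finset.mem_univ, true_iff]
  have hval : ∀ i : Fin n, ((segEquiv n i : Seg n) : ℕ) = 1 + i := fun i => rfl
  constructor
  · rintro ⟨h1, h2, h3⟩
    refine ⟨fun r => ?_, fun j => ?_, fun j r hjr => ?_⟩
    · obtain ⟨i, hi⟩ := h2 r
      refine Finset.card_eq_one.2 ⟨segEquiv n i, ?_⟩
      ext j
      simp only [Finset.mem_filter, Finset.mem_univ, true_and, Finset.mem_singleton]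
      constructor
      · intro hj
        have := h3 r ((segEquiv n).symm j) i (by simpa using hj) hi
        rw [← this, Equiv.apply_symm_apply]
      · rintro rfl; exact hi
    · have := (h1 ((segEquiv n).symm j)).1
      simpa [columnRows] using this
    · have := (h1 ((segEquiv n).symm j)).2 r (by simpa using hjr)
      rw [← hval, Equiv.apply_symm_apply] at this
      exact this
  · rintro ⟨h1, h2, h3⟩
    refine ⟨fun i => ⟨h2 _, fun r hr => h3 _ _ hr⟩, fun r => ?_, fun r i j hi hj => ?_⟩
    · obtain ⟨j, hj⟩ := Finset.card_pos.1 (by rw [h1 r]; exact one_pos)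
      exact ⟨(segEquiv n).symm j, by simpa using hj⟩
    · apply (segEquiv n).injective
      exact Finset.card_le_one.1 (h1 r).le _ (by simpa using hi) _ (by simpa using hj)

theorem prod_columnRows {n : ℕ} (D : Finset (Seg n × Seg (2 * n))) :
    ∏ i, ∏ r ∈ columnRows D i, rowWeight n (1 + (i : ℕ)) r =
      X ^ (D.filter (fun d => 2 * n + 1 ≤ (d.2 : ℕ) + (d.1 : ℕ))).card := by
  have h : ∏ d ∈ D, rowWeight n (d.1 : ℕ) (d.2 : ℕ) =
      ∏ j : Seg n, ∏ r ∈ Finset.univ.filter (fun r => (j, r) ∈ D), rowWeight n (j : ℕ) r :=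
    Finset.prod_finset_product D Finset.univ _ (fun p => by simp)
  rw [← (segEquiv n).prod_comp] at h
  refine Eq.trans h.symm ?_
  simp only [rowWeight]
  rw [Finset.prod_ite, Finset.prod_const, Finset.prod_const_one, mul_one]

theorem sum_tableau_eq (n : ℕ) :
    ∑ T : Tableau n, (X : ℕ[X]) ^ T.fr = tableauSum n n 1 (Finset.Icc 1 (2 * n)) := by
  classical
  have hR : Finset.Icc 1 (2 * n) = rowVals (Finset.univ : Finset (Seg (2 * n))) := by
    ext x; simp [rowVals]
  refine Eq.trans ?_ (congrArg (tableauSum n n 1) hR.symm)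
  rw [tableauSum_eq_sum_fillings, ← (columnRows_bijective n (2 * n)).sum_comp]
  simp only [isFilling_columnRows, prod_columnRows]
  rw [← Finset.sum_filter]
  exact (Finset.sum_subtype (p := fun D : Finset (Seg n × Seg (2 * n)) =>
    (∀ i : Seg (2 * n), (Finset.univ.filter (fun j : Seg n => (j, i) ∈ D)).card = 1) ∧
    (∀ j : Seg n, (Finset.univ.filter (fun i : Seg (2 * n) => (j, i) ∈ D)).card = 2) ∧
    (∀ (j : Seg n) (i : Seg (2 * n)), (j, i) ∈ D → (j : ℕ) ≤ (i : ℕ))) _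
    (fun D => by simp only [Finset.mem_filter, Finset.mem_univ, true_and])
    (fun D => (X : ℕ[X]) ^ (D.filter (fun d => 2 * n + 1 ≤ (d.2 : ℕ) + (d.1 : ℕ))).card)).symm

end TableauEnumeration

/-! ### Identifying `pistolSum` with the sum over pistols. -/

section PistolEnumeration

open Polynomial

/-- The values in `A` together with those taken before stage `i`. -/
def valuesBefore {N m : ℕ} (A : Finset ℕ) (g : Fin m → Seg N × Seg N) (i : Fin m) : Finset ℕ :=
  A ∪ (Finset.univ.filter (· < i)).biUnion fun j => {((g j).1 : ℕ), ((g j).2 : ℕ)}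

theorem mem_valuesBefore {N m v : ℕ} {A : Finset ℕ} {g : Fin m → Seg N × Seg N} {i : Fin m} :
    v ∈ valuesBefore A g i ↔ v ∈ A ∨ ∃ j < i, v = (g j).1 ∨ v = (g j).2 := by
  simp [valuesBefore]

/-- The weight of the choice of the values at the two positions `2 * k - 1` and `2 * k`. -/
noncomputable def stageWeight (n k : ℕ) (A : Finset ℕ) (x y : ℕ) : ℕ[X] :=
  if k ≤ x ∧ k ≤ y then valueWeight n k A x y else 0

theorem sum_seg_ite {n k : ℕ} (hk : 1 ≤ k) (φ : ℕ → ℕ[X]) :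
    ∑ x : Seg n, (if k ≤ (x : ℕ) then φ x else 0) = ∑ x ∈ Finset.Icc k n, φ x := by
  rw [Finset.sum_coe_sort (Finset.Icc 1 n) fun x => if k ≤ x then φ x else 0,
    ← Finset.sum_filter]
  refine Finset.sum_congr ?_ fun _ _ => rfl
  ext x
  simp only [Finset.mem_filter, Finset.mem_Icc]
  omega

theorem pistolSum_eq_sum {n m k : ℕ} (hk : 1 ≤ k) (A : Finset ℕ) :
    pistolSum n m k A = ∑ g : Fin m → Seg n × Seg n,
      ∏ i : Fin m, stageWeight n (k + (i : ℕ)) (valuesBefore A g i) (g i).1 (g i).2 := by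
  induction m generalizing k A with
  | zero => simp [pistolSum]
  | succ m ih =>
    rw [← (Fin.consEquiv fun _ : Fin (m + 1) => Seg n × Seg n).sum_comp, Fintype.sum_prod_type,
      Fintype.sum_prod_type, pistolSum, ← sum_seg_ite hk]
    refine Finset.sum_congr rfl fun x _ => ?_
    rw [← sum_seg_ite hk]
    have hstep : ∀ y : Seg n, ∑ g : Fin m → Seg n × Seg n,
        ∏ i : Fin (m + 1), stageWeight n (k + (i : ℕ))
          (valuesBefore A (Fin.cons (x, y) g : Fin (m + 1) → Seg n × Seg n) i)
          ((Fin.cons (x, y) g : Fin (m + 1) → Seg n × Seg n) i).1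
          ((Fin.cons (x, y) g : Fin (m + 1) → Seg n × Seg n) i).2 =
        stageWeight n k A x y * pistolSum n m (k + 1) (insert (x : ℕ) (insert (y : ℕ) A)) := by
      intro y
      rw [ih (by omega), Finset.mul_sum]
      refine Finset.sum_congr rfl fun g _ => ?_
      rw [Fin.prod_univ_succ]
      congr 1
      · congr 1
        ext v
        simp [mem_valuesBefore]
      · refine Finset.prod_congr rfl fun i _ => ?_
        have e : k + ((i.succ : Fin (m + 1)) : ℕ) = k + 1 + i := by rw [Fin.val_succ]; ring
        rw [e]
        congr 1
        ext v
        simp only [mem_valuesBefore, Finset.mem_insert, Fin.exists_fin_succ, Fin.cons_zero,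
          Fin.cons_succ, Fin.succ_pos, Fin.succ_lt_succ_iff, true_and]
        constructor
        · rintro (h | (h | h) | h)
          exacts [.inl (.inr (.inr h)), .inl (.inl h), .inl (.inr (.inl h)), .inr h]
        · rintro ((h | h | h) | h)
          exacts [.inr (.inl (.inl h)), .inr (.inl (.inr h)), .inl h, .inr (.inr h)]
    refine Eq.trans ?_ (Finset.sum_congr rfl fun y _ => (hstep y).symm)
    by_cases hx : k ≤ (x : ℕ)
    · rw [if_pos hx]
      refine Finset.sum_congr rfl fun y _ => ?_
      by_cases hy : k ≤ (y : ℕ) <;> simp [stageWeight, hx, hy]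
    · rw [if_neg hx]
      symm
      refine Finset.sum_eq_zero fun y _ => ?_
      simp [stageWeight, hx]

/-- Division by two. -/
def evensEquiv (n : ℕ) : Evens n ≃ Seg n where
  toFun m := ⟨(m : ℕ) / 2, by
    obtain ⟨i, hi, h⟩ := Finset.mem_image.1 m.2
    rw [← h, Nat.mul_div_cancel_left i two_pos]
    exact hi⟩
  invFun i := ⟨2 * (i : ℕ), Finset.mem_image_of_mem _ i.2⟩
  left_inv m := by
    obtain ⟨i, _, h⟩ := Finset.mem_image.1 m.2
    ext
    simp only
    omega
  right_inv i := by ext; simp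

theorem two_mul_evensEquiv {n : ℕ} (m : Evens n) : 2 * (evensEquiv n m : ℕ) = m :=
  congrArg Subtype.val ((evensEquiv n).symm_apply_apply m)

/-- The position `2 * k - 1`, for `k = i + 1`. -/
def oddPos {n : ℕ} (i : Fin n) : Seg (2 * n) :=
  ⟨2 * i + 1, Finset.mem_Icc.2 ⟨by omega, by omega⟩⟩

/-- The position `2 * k`, for `k = i + 1`. -/
def evenPos {n : ℕ} (i : Fin n) : Seg (2 * n) :=
  ⟨2 * i + 2, Finset.mem_Icc.2 ⟨by omega, by omega⟩⟩

theorem exists_eq_pos {n : ℕ} (j : Seg (2 * n)) : ∃ i : Fin n, j = oddPos i ∨ j = evenPos i := by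
  have hj := Finset.mem_Icc.1 j.2
  refine ⟨⟨((j : ℕ) - 1) / 2, by omega⟩, ?_⟩
  rcases Nat.even_or_odd' (j : ℕ) with ⟨c, h | h⟩
  · right
    ext
    simp only [evenPos]
    omega
  · left
    ext
    simp only [oddPos]
    omega

/-- The half values of a map at the pairs of consecutive positions. -/
def stageValues {n : ℕ} (f : Seg (2 * n) → Evens n) (i : Fin n) : Seg n × Seg n :=
  (evensEquiv n (f (oddPos i)), evensEquiv n (f (evenPos i)))

theorem stageValues_bijective (n : ℕ) :
    Function.Bijective (stageValues : (Seg (2 * n) → Evens n) → Fin n → Seg n × Seg n) := by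
  constructor
  · intro f f' h
    funext j
    obtain ⟨i, rfl | rfl⟩ := exists_eq_pos j
    · exact (evensEquiv n).injective (congrArg Prod.fst (congrFun h i))
    · exact (evensEquiv n).injective (congrArg Prod.snd (congrFun h i))
  · intro g
    refine ⟨fun j => (evensEquiv n).symm
      (if (j : ℕ) % 2 = 1 then
        (g ⟨((j : ℕ) - 1) / 2, by have := Finset.mem_Icc.1 j.2; omega⟩).1
      else (g ⟨((j : ℕ) - 1) / 2, by have := Finset.mem_Icc.1 j.2; omega⟩).2), ?_⟩
    funext i
    have h1 : (⟨((oddPos i : Seg (2 * n)) - 1 : ℕ) / 2, by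
        have := Finset.mem_Icc.1 (oddPos i).2; omega⟩ : Fin n) = i := by
      ext; simp only [oddPos]; omega
    have h2 : (⟨((evenPos i : Seg (2 * n)) - 1 : ℕ) / 2, by
        have := Finset.mem_Icc.1 (evenPos i).2; omega⟩ : Fin n) = i := by
      ext; simp only [evenPos]; omega
    have h3 : ((oddPos i : Seg (2 * n)) : ℕ) % 2 = 1 := by simp only [oddPos]; omega
    have h4 : ¬ ((evenPos i : Seg (2 * n)) : ℕ) % 2 = 1 := by simp only [evenPos]; omega
    simp only [stageValues, Equiv.apply_symm_apply, h3, h4, if_true, if_false, h1, h2]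

theorem le_evensEquiv_iff {n : ℕ} (i : ℕ) (m : Evens n) :
    1 + i ≤ (evensEquiv n m : ℕ) ↔ 2 * i + 1 ≤ (m : ℕ) := by
  have := two_mul_evensEquiv m
  omega

/-- The values taken up to position `2 * i`. -/
theorem mem_valuesBefore_stageValues {n v : ℕ} {f : Seg (2 * n) → Evens n} {i : Fin n} :
    v ∈ valuesBefore ∅ (stageValues f) i ↔
      ∃ j : Seg (2 * n), (j : ℕ) ≤ 2 * i ∧ (f j : ℕ) = 2 * v := by
  have hv : ∀ m : Evens n, v = (evensEquiv n m : ℕ) ↔ (m : ℕ) = 2 * v := fun m => by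
    have := two_mul_evensEquiv m
    omega
  simp only [mem_valuesBefore, Finset.notMem_empty, false_or, stageValues, hv]
  constructor
  · rintro ⟨j, hj, h | h⟩
    · exact ⟨oddPos j, by simp only [oddPos]; omega, h⟩
    · exact ⟨evenPos j, by simp only [evenPos]; omega, h⟩
  · rintro ⟨j, hj, h⟩
    obtain ⟨c, rfl | rfl⟩ := exists_eq_pos j
    · exact ⟨c, by simp only [oddPos] at hj; omega, Or.inl h⟩
    · exact ⟨c, by simp only [evenPos] at hj; omega, Or.inr h⟩

/-- Values are even, so positions `2i + 1` and `2i + 2` impose the same bound. -/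
theorem le_apply_iff_stageValues {n : ℕ} {f : Seg (2 * n) → Evens n} :
    (∀ j : Seg (2 * n), (j : ℕ) ≤ (f j : ℕ)) ↔
      ∀ i : Fin n, 1 + (i : ℕ) ≤ ((stageValues f i).1 : ℕ) ∧
        1 + (i : ℕ) ≤ ((stageValues f i).2 : ℕ) := by
  simp only [stageValues, le_evensEquiv_iff]
  constructor
  · intro h i
    have h1 : 2 * (i : ℕ) + 1 ≤ f (oddPos i) := h (oddPos i)
    have h2 : 2 * (i : ℕ) + 2 ≤ f (evenPos i) := h (evenPos i)
    exact ⟨h1, by omega⟩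
  · intro h j
    obtain ⟨i, rfl | rfl⟩ := exists_eq_pos j
    · exact (h i).1
    · have h1 := (h i).2
      have h2 := two_mul_evensEquiv (f (evenPos i))
      have h3 : ((evenPos i : Seg (2 * n)) : ℕ) = 2 * i + 2 := rfl
      omega

/-- Since `f j ≥ j`, the value `2(i + 1)` can be taken only at positions up to `2i + 2`;
surjectivity thus becomes a condition checked stage by stage. -/
theorem surjective_iff_stageValues {n : ℕ} {f : Seg (2 * n) → Evens n}
    (hf : ∀ j : Seg (2 * n), (j : ℕ) ≤ (f j : ℕ)) :
    Function.Surjective f ↔ ∀ i : Fin n, 1 + (i : ℕ) ∈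
      insert ((stageValues f i).1 : ℕ) (insert ((stageValues f i).2 : ℕ)
        (valuesBefore ∅ (stageValues f) i)) := by
  have hv : ∀ (i : Fin n) (m : Evens n),
      1 + (i : ℕ) = (evensEquiv n m : ℕ) ↔ (m : ℕ) = 2 * (1 + i) := fun i m => by
    have := two_mul_evensEquiv m
    omega
  simp only [Finset.mem_insert, mem_valuesBefore_stageValues]
  simp only [stageValues, hv]
  constructor
  · intro h i
    obtain ⟨j, hj⟩ := h ((evensEquiv n).symm (segEquiv n i))
    have hj' : (f j : ℕ) = 2 * (1 + i) := by rw [hj]; rfl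
    obtain ⟨c, rfl | rfl⟩ := exists_eq_pos j
    · have h1 : 2 * (c : ℕ) + 1 ≤ f (oddPos c) := hf (oddPos c)
      by_cases hc : c = i
      · subst hc; exact Or.inl hj'
      · have : (c : ℕ) ≠ i := fun h => hc (Fin.ext h)
        exact Or.inr (Or.inr ⟨oddPos c, by simp only [oddPos]; omega, hj'⟩)
    · have h1 : 2 * (c : ℕ) + 2 ≤ f (evenPos c) := hf (evenPos c)
      by_cases hc : c = i
      · subst hc; exact Or.inr (Or.inl hj')
      · have : (c : ℕ) ≠ i := fun h => hc (Fin.ext h)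
        exact Or.inr (Or.inr ⟨evenPos c, by simp only [evenPos]; omega, hj'⟩)
  · intro h m
    set i := (segEquiv n).symm (evensEquiv n m) with hi
    have hm : (m : ℕ) = 2 * (1 + i) := by
      rw [← two_mul_evensEquiv m, ← (segEquiv n).apply_symm_apply (evensEquiv n m)]
      rfl
    rcases h i with h | h | ⟨j, _, h⟩
    · exact ⟨oddPos i, Subtype.ext (h.trans hm.symm)⟩
    · exact ⟨evenPos i, Subtype.ext (h.trans hm.symm)⟩
    · exact ⟨j, Subtype.ext (h.trans hm.symm)⟩

theorem isDoubledFixedPoint_iff {n : ℕ} (f : SurjectivePistol n) (i : Fin n) :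
    f.IsDoubledFixedPoint (2 * (1 + (i : ℕ))) ↔
      ((stageValues f.val i).2 : ℕ) = 1 + i ∧
        (((stageValues f.val i).1 : ℕ) = 1 + i ∨
          1 + (i : ℕ) ∈ valuesBefore ∅ (stageValues f.val) i) ∧ 1 + (i : ℕ) < n := by
  have hv : ∀ m : Evens n, (evensEquiv n m : ℕ) = 1 + i ↔ (m : ℕ) = 2 * (1 + i) := fun m => by
    have := two_mul_evensEquiv m
    omega
  rw [mem_valuesBefore_stageValues]
  simp only [stageValues, hv, SurjectivePistol.IsDoubledFixedPoint]
  constructor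
  · rintro ⟨h1, j, j', hj, hj', h2, h3⟩
    have hje : j = evenPos i := Subtype.ext (by rw [hj]; simp only [evenPos]; omega)
    subst hje
    refine ⟨h3, ?_, by omega⟩
    by_cases h : j' = oddPos i
    · subst h; exact Or.inl h2
    · refine Or.inr ⟨j', ?_, h2⟩
      have h4 : (j' : ℕ) ≠ 2 * i + 1 := fun h' => h (Subtype.ext h')
      have h5 : (j' : ℕ) < 2 * i + 2 := hj'
      omega
  · rintro ⟨h1, h2, h3⟩
    refine ⟨by omega, evenPos i, ?_⟩
    have he : ((evenPos i : Seg (2 * n)) : ℕ) = 2 * (1 + i) := by simp only [evenPos]; omega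
    rcases h2 with h2 | ⟨j, hj, h2⟩
    · exact ⟨oddPos i, he, Subtype.mk_lt_mk.2 (by omega), h2, h1⟩
    · refine ⟨j, he, ?_, h2, h1⟩
      rw [← Subtype.coe_lt_coe, he]
      omega

theorem X_pow_ndf {n : ℕ} (f : SurjectivePistol n) :
    (X : ℕ[X]) ^ f.ndf = ∏ i : Fin n, stageWeight n (1 + (i : ℕ))
      (valuesBefore ∅ (stageValues f.val) i) (stageValues f.val i).1 (stageValues f.val i).2 := by
  have h1 := le_apply_iff_stageValues.1 f.2.2
  have h2 := (surjective_iff_stageValues f.2.2).1 f.2.1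
  have h3 : ∀ i : Fin n, stageWeight n (1 + (i : ℕ)) (valuesBefore ∅ (stageValues f.val) i)
      (stageValues f.val i).1 (stageValues f.val i).2 =
      if ¬ f.IsDoubledFixedPoint (2 * (1 + (i : ℕ))) then X else 1 := by
    intro i
    rw [stageWeight, if_pos (h1 i), valueWeight, if_pos (h2 i)]
    simp only [isDoubledFixedPoint_iff, ite_not]
  rw [Finset.prod_congr rfl fun i _ => h3 i,
    ← ((segEquiv n).trans (evensEquiv n).symm).symm.prod_comp]
  have h4 : ∀ m : Evens n,
      2 * (1 + ((((segEquiv n).trans (evensEquiv n).symm).symm m : Fin n) : ℕ)) = (m : ℕ) := by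
    intro m
    rw [← two_mul_evensEquiv m]
    congr 1
    exact congrArg Subtype.val ((segEquiv n).apply_symm_apply (evensEquiv n m))
  simp only [h4]
  rw [Finset.prod_ite, Finset.prod_const, Finset.prod_const_one, mul_one]
  rfl

theorem sum_pistol_eq (n : ℕ) :
    ∑ f : SurjectivePistol n, (X : ℕ[X]) ^ f.ndf = pistolSum n n 1 ∅ := by
  classical
  rw [pistolSum_eq_sum le_rfl, ← (stageValues_bijective n).sum_comp,
    Finset.sum_congr rfl fun f _ => X_pow_ndf f]
  let w : (Seg (2 * n) → Evens n) → ℕ[X] := fun f => ∏ i : Fin n, stageWeight n (1 + (i : ℕ))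
    (valuesBefore ∅ (stageValues f) i) (stageValues f i).1 (stageValues f i).2
  have h : ∑ f : SurjectivePistol n, w f.val = ∑ f ∈ Finset.univ.filter
      (fun f : Seg (2 * n) → Evens n =>
        Function.Surjective f ∧ ∀ j : Seg (2 * n), (j : ℕ) ≤ (f j : ℕ)), w f :=
    (Finset.sum_subtype _ (fun f => by simp only [Finset.mem_filter, Finset.mem_univ, true_and])
      w).symm
  -- A map that is not a surjective pistol has a vanishing factor at some stage.
  refine h.trans (Finset.sum_subset (Finset.subset_univ _) fun f _ hf => ?_)
  rw [Finset.mem_filter] at hf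
  by_cases h1 : ∀ j : Seg (2 * n), (j : ℕ) ≤ (f j : ℕ)
  · have h2 : ¬ Function.Surjective f := fun h => hf ⟨Finset.mem_univ _, h, h1⟩
    rw [surjective_iff_stageValues h1, not_forall] at h2
    obtain ⟨i, hi⟩ := h2
    refine Finset.prod_eq_zero (Finset.mem_univ i) ?_
    rw [stageWeight, valueWeight, if_neg hi, ite_self]
  · rw [le_apply_iff_stageValues, not_forall] at h1
    obtain ⟨i, hi⟩ := h1
    exact Finset.prod_eq_zero (Finset.mem_univ i) (if_neg hi)

end PistolEnumeration

theorem mainTheorem2 (n : ℕ) (hn : 1 ≤ n) :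
    ∃ φ : Tableau n → SurjectivePistol n, Function.Surjective φ ∧
      ∀ f : SurjectivePistol n,
        ∑ T ∈ Finset.univ.filter (fun T : Tableau n => φ T = f), 2 ^ T.fr = 2 ^ f.ndf := by
  have h := tableauSum_refines_pistolSum hn
  rw [← sum_tableau_eq, ← sum_pistol_eq] at h
  exact h.exists_fibre_sum
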